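/- Let $\Omega\subset\mathbb R^d$ be convex and compact and let $0<\alpha<1$. For a non-negative Borel measure $\lambda$ on $\Omega$ put $G_\alpha(\lambda)=\sum_{x\in\Omega}\lambda(\{x\})^\alpha$ if $\lambda$ is purely atomic (concentrated on a countable set), and $G_\alpha(\lambda)=+\infty$ otherwise. For $\rho\in\mathcal P(\Omega)$ and an $\mathbb R^d$-valued measure $q$ on $\Omega$ put $F(\rho,q)=G_\alpha(|v|^{1/\alpha}\cdot\rho)$ if $q=v\cdot\rho$ for some density $v$, and $F(\rho,q)=+\infty$ if $q$ is not absolutely continuous with respect to $\rho$. Consider pairs $(\rho,q)$ with $$\rho\in C([0,1];\mathcal P(\Omega)),\qquad q\in L^1([0,1];\mathcal M(\Omega;\mathbb R^d)),\tag{1}$$ where $\mathcal P(\Omega)$ carries the weak convergence of measures and the second condition means that $t\mapsto q_t$ is weakly-$*$ measurable with $\int_0^1|q_t|(\Omega)\,dt<\infty$. For such pairs let $\mathcal F(\rho,q)=\int_0^1F(\rho_t,q_t)\,dt$. Let $\mathfrak D$ be the set of the pairs (1) that solve the continuity equation $\partial_t\rho+\operatorname{div}_xq=0$ with no flux through $\partial\Omega$,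 i.e. $$\int_0^1\Big[\int_\Omega\partial_t\phi(t,x)\,d\rho_t(x)+\int_\Omega D_x\phi(t,x)\cdot dq_t(x)\Big]dt=0$$ for every smooth function $\phi$ on $\mathbb R\times\mathbb R^d$ with $\phi(0,x)=\phi(1,x)=0$ for all $x\in\Omega$. Let $(\rho^n,q^n)\in\mathfrak D$ for $n\in\mathbb N$, and let $(\rho,q)$ be a pair as in (1). Suppose that $(\rho^n,q^n)$ $\tau$-converges to $(\rho,q)$, that is: * for all continuous $\varphi:[0,1]\times\Omega\to\mathbb R$ and $\Phi:[0,1]\times\Omega\to\mathbb R^d$, $$\int_0^1\!\!\int_\Omega\varphi\,d\rho^n_t\,dt\to\int_0^1\!\!\int_\Omega\varphi\,d\rho_t\,dt,\qquad \int_0^1\!\!\int_\Omega\Phi\cdot dq^n_t\,dt\to\int_0^1\!\!\int_\Omega\Phi\cdot dq_t\,dt$$ (weak convergence of measures on $[0,1]\times\Omega$); * there is a constant $C<\infty$ such that, for every $n$, $F(\rho^n_t,q^n_t)\le C$ for almost every $t\in[0,1]$. Then $$\mathcal F(\rho,q)\le\liminf_{n\to\infty}\mathcal F(\rho^n,q^n).$$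 Moreover, for almost every $t\in[0,1]$, the measure $q_t$ is absolutely continuous with respect to $\rho_t$ and purely atomic. -/

import Mathlib

open MeasureTheory Filter Topology
open scoped ENNReal NNReal unitInterval ContDiff

namespace BranchedTransport

noncomputable section

/-- A measure is purely atomic if it is concentrated on a countable set of points. -/
def IsPurelyAtomic {X : Type*} [MeasurableSpace X] (μ : Measure X) : Prop :=
  ∃ S : Set X, S.Countable ∧ μ Sᶜ = 0

open Classical in
/-- The functional `G_α`: it is `∑ x, λ({x}) ^ α` if `λ` is purely atomic and `+∞` otherwise. -/
def G {X : Type*} [MeasurableSpace X] (α : ℝ) (μ : Measure X) : ℝ≥0∞ :=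
  if IsPurelyAtomic μ then ∑' x : X, μ {x} ^ α else ⊤

/-- The functional `F(ρ, q)`: it is `G_α(|v| ^ (1/α) · ρ)` if `q = v · ρ`, and `+∞` if `q` has no
density with respect to `ρ`. The density `v` is unique up to `ρ`-null sets, so the infimum below
runs over a single value when a density exists, and it is `+∞` when there is none. -/
def F {d : ℕ} {Ω : Set (EuclideanSpace ℝ (Fin d))} (α : ℝ) (ρ : ProbabilityMeasure Ω)
    (q : VectorMeasure Ω (EuclideanSpace ℝ (Fin d))) : ℝ≥0∞ :=
  ⨅ (v : Ω → EuclideanSpace ℝ (Fin d)) (_ : Integrable v (ρ : Measure Ω))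
    (_ : q = (ρ : Measure Ω).withDensityᵥ v),
    G α ((ρ : Measure Ω).withDensity fun x => ‖v x‖ₑ ^ (1 / α))

/-- The cost `∫₀¹ F(ρ_t, q_t) dt` of a pair of time-dependent measures. -/
def cost {d : ℕ} {Ω : Set (EuclideanSpace ℝ (Fin d))} (α : ℝ) (ρ : C(I, ProbabilityMeasure Ω))
    (q : I → VectorMeasure Ω (EuclideanSpace ℝ (Fin d))) : ℝ≥0∞ :=
  ∫⁻ t : I, F α (ρ t) (q t)

/-- The pairing `∫ f · dq` of a vector field with a vector measure. -/
def pairing {d : ℕ} {Ω : Set (EuclideanSpace ℝ (Fin d))} (f : Ω → EuclideanSpace ℝ (Fin d))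
    (q : VectorMeasure Ω (EuclideanSpace ℝ (Fin d))) : ℝ :=
  ∫ᵛ x, f x ∂[innerSL ℝ; q]

/-- `q ∈ L¹([0,1]; M(Ω; ℝᵈ))`: the curve `t ↦ q_t` is weakly-* measurable and its total variation
is integrable in time. -/
structure IsL1Curve {d : ℕ} {Ω : Set (EuclideanSpace ℝ (Fin d))}
    (q : I → VectorMeasure Ω (EuclideanSpace ℝ (Fin d))) : Prop where
  measurable : ∀ f : C(Ω, EuclideanSpace ℝ (Fin d)),
    AEStronglyMeasurable (fun t : I => pairing f (q t)) volume
  integrable : ∫⁻ t : I, (q t).variation Set.univ < (⊤ : ℝ≥0∞)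

/-- The continuity equation `∂ₜρ + div q = 0` in `[0,1] × Ω` with `q · ν = 0` on the boundary, in
the sense of distributions. -/
def ContinuityEquation {d : ℕ} {Ω : Set (EuclideanSpace ℝ (Fin d))}
    (ρ : C(I, ProbabilityMeasure Ω)) (q : I → VectorMeasure Ω (EuclideanSpace ℝ (Fin d))) : Prop :=
  ∀ φ : ℝ × EuclideanSpace ℝ (Fin d) → ℝ, ContDiff ℝ ∞ φ →
    (∀ x ∈ Ω, φ (0, x) = 0 ∧ φ (1, x) = 0) →
    ∫ t : I, ((∫ x : Ω, deriv (fun s : ℝ => φ (s, x)) t ∂(ρ t : Measure Ω)) +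
      pairing (fun x : Ω => gradient (fun y => φ ((t : ℝ), y)) (x : EuclideanSpace ℝ (Fin d)))
        (q t)) = 0

/-- The set `𝔇` of admissible pairs. -/
structure Admissible {d : ℕ} {Ω : Set (EuclideanSpace ℝ (Fin d))}
    (ρ : C(I, ProbabilityMeasure Ω)) (q : I → VectorMeasure Ω (EuclideanSpace ℝ (Fin d))) :
    Prop where
  isL1Curve : IsL1Curve q
  continuityEquation : ContinuityEquation ρ q

/-- `τ`-convergence: weak convergence of the space-time measures `∫ ρⁿ_t dt` and `∫ qⁿ_t dt` on
`[0,1] × Ω`, together with a bound on `F(ρⁿ_t, qⁿ_t)` that is uniform in `n` and `t`. As the curves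
`qⁿ` are only determined up to null sets of times, the bound is asked for almost every `t`. -/
structure TauConverges {d : ℕ} {Ω : Set (EuclideanSpace ℝ (Fin d))} (α : ℝ)
    (ρn : ℕ → C(I, ProbabilityMeasure Ω))
    (qn : ℕ → I → VectorMeasure Ω (EuclideanSpace ℝ (Fin d)))
    (ρ : C(I, ProbabilityMeasure Ω))
    (q : I → VectorMeasure Ω (EuclideanSpace ℝ (Fin d))) : Prop where
  tendsto_density : ∀ φ : C(I × Ω, ℝ),
    Tendsto (fun n => ∫ t : I, ∫ x : Ω, φ (t, x) ∂(ρn n t : Measure Ω)) atTop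
      (𝓝 (∫ t : I, ∫ x : Ω, φ (t, x) ∂(ρ t : Measure Ω)))
  tendsto_flux : ∀ Φ : C(I × Ω, EuclideanSpace ℝ (Fin d)),
    Tendsto (fun n => ∫ t : I, pairing (fun x : Ω => Φ (t, x)) (qn n t)) atTop
      (𝓝 (∫ t : I, pairing (fun x : Ω => Φ (t, x)) (q t)))
  bounded : ∃ C : ℝ≥0, ∀ n, ∀ᵐ t : I, F α (ρn n t) (qn n t) ≤ C

end

end BranchedTransport

/-! At an atom of mass r where q has density v, one has (|v|^(1/α) r)^α = r^(α-1) · |v| r. Hence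
F(ρ, q) is the integral of ρ({x})^(α-1) against |q|, with value +∞ when |q| charges points that are
not atoms of ρ (`atomicCost_le_F`, `F_le_atomicCost`). This is a total variation with a weight that
depends on ρ. For a fixed continuous weight it would be lower semicontinuous by duality; the
difficulty is that the weight is discontinuous and changes with n.

Both problems are met by a larger, continuous substitute for ρ({x}): the integral of exp(-j|y-x|²)
dρ(y), called `smoothedMass`. It dominates ρ({x}) and tends to it as j → ∞. As ρ has mass at most 1
at a point and α - 1 < 0, the bound F ≤ C also bounds the mass of the fluxes. The continuity
equation then makes the smoothed masses of ρⁿ Lipschitz in time and space, uniformly in n, so that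
weak convergence in space-time becomes uniform convergence for each j
(`tendstoUniformly_smoothedMass`).

For n large, ρⁿ_t({x}) is therefore at most 1/(j+1) plus the smoothed mass of ρ_t. The power α - 1
of this quantity is a continuous weight, independent of n, whose integral against |qⁿ| is at most
the cost. Duality passes this bound to q (`lintegral_weighted_variation_le`), and Fatou's lemma in j
restores the weight ρ_t({x})^(α-1). The uniform bound makes the limiting cost finite, so for almost
every t the flux lives on the countably many atoms of ρ_t. -/

namespace BranchedTransport

noncomputable section

/-! ### Retraction onto the unit ball. -/

section RadialTruncation

variable {V : Type*} [NormedAddCommGroup V] [NormedSpace ℝ V]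

/-- The radial retraction of a normed space onto its closed unit ball. -/
def radialTrunc (x : V) : V := (max 1 ‖x‖)⁻¹ • x

lemma norm_radialTrunc_le (x : V) : ‖radialTrunc x‖ ≤ 1 := by
  have h : 0 < max 1 ‖x‖ := lt_of_lt_of_le one_pos (le_max_left _ _)
  rw [radialTrunc, norm_smul, norm_inv, Real.norm_of_nonneg h.le, inv_mul_le_one₀ h]
  exact le_max_right _ _

lemma continuous_radialTrunc : Continuous (radialTrunc : V → V) := by
  unfold radialTrunc
  refine Continuous.smul (Continuous.inv₀ (by fun_prop) fun x => ?_) continuous_id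
  exact (lt_of_lt_of_le one_pos (le_max_left _ _)).ne'

/-- The retraction moves x by its distance to the ball, which is at most ‖s - x‖; the triangle
inequality gives the factor 2. Approximants can thus be forced into the unit ball at the price of
doubling the error. -/
lemma norm_sub_radialTrunc_le {s : V} (hs : ‖s‖ ≤ 1) (x : V) :
    ‖s - radialTrunc x‖ ≤ 2 * ‖s - x‖ := by
  have hx : ‖x - radialTrunc x‖ ≤ ‖s - x‖ := by
    have h : 0 < max 1 ‖x‖ := lt_of_lt_of_le one_pos (le_max_left _ _)
    have e : x - radialTrunc x = (1 - (max 1 ‖x‖)⁻¹) • x := by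
      rw [radialTrunc, sub_smul, one_smul]
    rcases le_total ‖x‖ 1 with h1 | h1
    · rw [e, max_eq_left h1]; simp
    · rw [e, max_eq_right h1, norm_smul, Real.norm_of_nonneg]
      · have : ‖x‖ ≠ 0 := by positivity
        rw [sub_mul, inv_mul_cancel₀ this, one_mul]
        have := norm_sub_norm_le x s
        rw [norm_sub_rev] at this
        linarith
      · rw [sub_nonneg]; exact inv_le_one_of_one_le₀ h1
  calc ‖s - radialTrunc x‖ = ‖(s - x) + (x - radialTrunc x)‖ := by congr 1; abel
    _ ≤ ‖s - x‖ + ‖x - radialTrunc x‖ := norm_add_le _ _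
    _ ≤ 2 * ‖s - x‖ := by linarith

end RadialTruncation

/-! ### Weakly-* measurable fields of functionals. -/

section WeakStarMeasurable

variable {V : Type*} [NormedAddCommGroup V] [NormedSpace ℝ V]
  {T : Type*} [MeasurableSpace T] {μ : Measure T}

/-- Evaluating a weakly-* measurable field of functionals along a strongly measurable field of
vectors gives a measurable function. -/
lemma aestronglyMeasurable_clm_apply {A : T → V →L[ℝ] ℝ}
    (hA : ∀ f, AEStronglyMeasurable (fun t => A t f) μ) {Ψ : T → V}
    (hΨ : AEStronglyMeasurable Ψ μ) : AEStronglyMeasurable (fun t => A t (Ψ t)) μ := by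
  have simple : ∀ s : SimpleFunc T V, AEStronglyMeasurable (fun t => A t (s t)) μ := by
    intro s
    induction s using SimpleFunc.induction with
    | const c hs =>
      rename_i S
      refine ((hA c).indicator hs).congr (Eventually.of_forall fun t => ?_)
      by_cases h : t ∈ S <;> simp [h]
    | add _ hf hg =>
      refine (hf.add hg).congr (Eventually.of_forall fun t => ?_)
      simp
  have key : AEStronglyMeasurable (fun t => A t (hΨ.mk Ψ t)) μ := by
    refine aestronglyMeasurable_of_tendsto_ae atTop
      (fun n => simple (hΨ.stronglyMeasurable_mk.approx n)) (Eventually.of_forall fun t => ?_)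
    exact ((A t).continuous.tendsto _).comp (hΨ.stronglyMeasurable_mk.tendsto_approx t)
  refine key.congr ?_
  filter_upwards [hΨ.ae_eq_mk] with t ht
  rw [ht]

/-- In a separable space one sequence in the unit ball computes the norm of every functional. -/
lemma exists_seq_opNorm_eq_iSup (V : Type*) [NormedAddCommGroup V] [NormedSpace ℝ V]
    [SecondCountableTopology V] :
    ∃ f : ℕ → V, (∀ k, ‖f k‖ ≤ 1) ∧ ∀ B : V →L[ℝ] ℝ, ‖B‖ₑ = ⨆ k, ENNReal.ofReal (B (f k)) := by
  have : Nonempty (Metric.closedBall (0 : V) 1) := ⟨⟨0, by simp⟩⟩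
  let f := TopologicalSpace.denseSeq (Metric.closedBall (0 : V) 1)
  refine ⟨fun k => f k, fun k => mem_closedBall_zero_iff.1 (f k).2, fun B => le_antisymm ?_ ?_⟩
  · refine le_of_forall_lt fun c hc => ?_
    have hc' : c ≠ ⊤ := hc.ne_top
    lift c to ℝ≥0 using hc'
    have hc : (c : ℝ) < ‖B‖ := by
      rw [← ofReal_norm, ← ENNReal.ofReal_coe_nnreal] at hc
      exact (ENNReal.ofReal_lt_ofReal_iff_of_nonneg c.2).1 hc
    obtain ⟨x, hx, hBx⟩ := B.exists_lt_apply_of_lt_opNorm hc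
    obtain ⟨y, hy, hBy⟩ : ∃ y : V, ‖y‖ < 1 ∧ (c : ℝ) < B y := by
      rcases le_total 0 (B x) with h | h
      · exact ⟨x, hx, by rwa [Real.norm_of_nonneg h] at hBx⟩
      · exact ⟨-x, by rwa [norm_neg], by rwa [Real.norm_of_nonpos h, ← map_neg] at hBx⟩
    have hopen : IsOpen {z : Metric.closedBall (0 : V) 1 | (c : ℝ) < B z} :=
      isOpen_lt continuous_const (B.continuous.comp continuous_subtype_val)
    obtain ⟨z, hz, k, rfl⟩ := (TopologicalSpace.denseRange_denseSeq
      (Metric.closedBall (0 : V) 1)).exists_mem_open hopen ⟨⟨y, by simpa using hy.le⟩, hBy⟩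
      |>.elim fun k hk => (⟨_, hk, k, rfl⟩ : ∃ z, (c : ℝ) < B z ∧ ∃ k, (f k : V) = z)
    refine lt_of_lt_of_le ?_ (le_iSup _ k)
    rw [← ENNReal.ofReal_coe_nnreal]
    exact (ENNReal.ofReal_lt_ofReal_iff_of_nonneg c.2).2 hz
  · refine iSup_le fun k => ?_
    rw [← ofReal_norm]
    refine ENNReal.ofReal_le_ofReal ?_
    calc B (f k) ≤ ‖B (f k)‖ := le_abs_self _
      _ ≤ ‖B‖ * ‖(f k : V)‖ := B.le_opNorm _
      _ ≤ ‖B‖ * 1 := by gcongr; exact mem_closedBall_zero_iff.1 (f k).2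
      _ = ‖B‖ := mul_one _

lemma aemeasurable_enorm_clm [SecondCountableTopology V] {B : T → V →L[ℝ] ℝ}
    (hB : ∀ f, AEStronglyMeasurable (fun t => B t f) μ) : AEMeasurable (fun t => ‖B t‖ₑ) μ := by
  obtain ⟨f, -, hf⟩ := exists_seq_opNorm_eq_iSup V
  simp_rw [hf]
  exact AEMeasurable.iSup fun k => (hB (f k)).aemeasurable.ennreal_ofReal

/-- Measurable selection: a simple field of vectors in the unit ball that maximizes finitely
many evaluations at once. -/
lemma exists_simpleFunc_maximizing {B : T → V →L[ℝ] ℝ}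
    (hB : ∀ f, AEStronglyMeasurable (fun t => B t f) μ) {f : ℕ → V} (hf : ∀ k, ‖f k‖ ≤ 1) (N : ℕ) :
    ∃ s : SimpleFunc T V, (∀ t, ‖s t‖ ≤ 1) ∧
      ∀ᵐ t ∂μ, 0 ≤ B t (s t) ∧ ∀ k < N, B t (f k) ≤ B t (s t) := by
  classical
  induction N with
  | zero => exact ⟨0, by simp, by simp⟩
  | succ N ih =>
    obtain ⟨s, hs, hsB⟩ := ih
    have hnull : NullMeasurableSet {t | B t (s t) < B t (f N)} μ :=
      nullMeasurableSet_lt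
        (aestronglyMeasurable_clm_apply hB s.stronglyMeasurable.aestronglyMeasurable).aemeasurable
        (hB (f N)).aemeasurable
    -- The set where the new candidate wins is only null-measurable; a simple function needs a
    -- measurable set, and an almost everywhere equal one suffices.
    obtain ⟨S, hS, hSe⟩ := hnull.exists_measurable_superset_ae_eq.imp fun S h => h.2
    refine ⟨SimpleFunc.piecewise S hS (SimpleFunc.const T (f N)) s, fun t => ?_, ?_⟩
    · by_cases h : t ∈ S
      · simpa [SimpleFunc.piecewise_apply, h] using hf N
      · simpa [SimpleFunc.piecewise_apply, h] using hs t
    · filter_upwards [hsB, hSe.mem_iff] with t ht hSt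
      by_cases h : t ∈ S
      · have h' : B t (s t) < B t (f N) := hSt.1 h
        simp only [SimpleFunc.piecewise_apply, h, if_true, SimpleFunc.const_apply]
        refine ⟨ht.1.trans h'.le, fun k hk => ?_⟩
        rcases Nat.lt_succ_iff_lt_or_eq.1 hk with hk | rfl
        · exact (ht.2 k hk).trans h'.le
        · exact le_rfl
      · have h' : B t (f N) ≤ B t (s t) := not_lt.1 fun hlt => h (hSt.2 hlt)
        simp only [SimpleFunc.piecewise_apply, h, if_false]
        refine ⟨ht.1, fun k hk => ?_⟩
        rcases Nat.lt_succ_iff_lt_or_eq.1 hk with hk | rfl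
        · exact ht.2 k hk
        · exact h'

lemma integrable_clm_apply {B : T → V →L[ℝ] ℝ}
    (hB : ∀ f, AEStronglyMeasurable (fun t => B t f) μ) (hfin : ∫⁻ t, ‖B t‖ₑ ∂μ ≠ ⊤) {Ψ : T → V}
    (hΨ : AEStronglyMeasurable Ψ μ) (hle : ∀ t, ‖Ψ t‖ ≤ 1) :
    Integrable (fun t => B t (Ψ t)) μ := by
  refine ⟨aestronglyMeasurable_clm_apply hB hΨ, lt_of_le_of_lt (lintegral_mono fun t => ?_)
    hfin.lt_top⟩
  rw [← ofReal_norm, ← ofReal_norm]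
  refine ENNReal.ofReal_le_ofReal (((B t).le_opNorm _).trans ?_)
  exact mul_le_of_le_one_right (norm_nonneg _) (hle t)

end WeakStarMeasurable

/-! ### Integrals of dual norms as suprema over continuous test fields. -/

section Duality

variable {V : Type*} [NormedAddCommGroup V] [NormedSpace ℝ V] [SecondCountableTopology V]
  {T : Type*} [PseudoMetricSpace T] [MeasurableSpace T] [BorelSpace T] {μ : Measure T}

/-- The integral of a bounded measurable field of vectors against a weakly-* measurable field of
functionals is approximated by continuous fields of vectors in the unit ball. -/
lemma exists_continuous_integral_clm_le {B : T → V →L[ℝ] ℝ}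
    (hB : ∀ f, AEStronglyMeasurable (fun t => B t f) μ) (hfin : ∫⁻ t, ‖B t‖ₑ ∂μ ≠ ⊤)
    (s : SimpleFunc T V) (hs : ∀ t, ‖s t‖ ≤ 1) {ε : ℝ} (hε : 0 < ε) :
    ∃ Ψ : C(T, V), (∀ t, ‖Ψ t‖ ≤ 1) ∧ ∫ t, B t (s t) ∂μ ≤ ∫ t, B t (Ψ t) ∂μ + ε := by
  have hm := aemeasurable_enorm_clm hB
  -- An L¹(ν) error in the test field is exactly what controls the error of the pairing. The radial
  -- truncation doubles it, hence the tolerance ε / 2.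
  let ν := μ.withDensity fun t => ‖B t‖ₑ
  have : IsFiniteMeasure ν := ⟨by simpa [ν] using hfin.lt_top⟩
  have hsν : Integrable s ν :=
    Integrable.of_bound s.stronglyMeasurable.aestronglyMeasurable 1 (Eventually.of_forall hs)
  obtain ⟨g, hg, -⟩ := hsν.exists_boundedContinuous_lintegral_sub_le
    (ε := ENNReal.ofReal (ε / 2)) (by simpa using hε)
  let Ψ : C(T, V) := ⟨fun t => radialTrunc (g t), continuous_radialTrunc.comp g.continuous⟩
  have hΨ : ∀ t, ‖Ψ t‖ ≤ 1 := fun t => norm_radialTrunc_le _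
  have hΨm : AEStronglyMeasurable Ψ μ := Ψ.continuous.stronglyMeasurable.aestronglyMeasurable
  have hsm : AEStronglyMeasurable s μ := s.stronglyMeasurable.aestronglyMeasurable
  refine ⟨Ψ, hΨ, ?_⟩
  have i1 := integrable_clm_apply hB hfin hsm hs
  have i2 := integrable_clm_apply hB hfin hΨm hΨ
  have hle : ∫⁻ t, ‖B t (s t) - B t (Ψ t)‖ₑ ∂μ ≤ ENNReal.ofReal ε := by
    calc ∫⁻ t, ‖B t (s t) - B t (Ψ t)‖ₑ ∂μ
        ≤ ∫⁻ t, ‖B t‖ₑ * (2 * ‖s t - g t‖ₑ) ∂μ := by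
          refine lintegral_mono fun t => ?_
          rw [← map_sub, ← ofReal_norm, ← ofReal_norm, ← ofReal_norm,
            ← ENNReal.ofReal_ofNat, ← ENNReal.ofReal_mul (by norm_num),
            ← ENNReal.ofReal_mul (norm_nonneg _)]
          refine ENNReal.ofReal_le_ofReal (((B t).le_opNorm _).trans ?_)
          gcongr
          exact norm_sub_radialTrunc_le (hs t) _
      _ = ∫⁻ t, 2 * ‖s t - g t‖ₑ ∂ν := by
          rw [lintegral_withDensity_eq_lintegral_mul₀ hm]
          · rfl
          · have : AEStronglyMeasurable (fun t => s t - g t) μ :=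
              hsm.sub g.continuous.stronglyMeasurable.aestronglyMeasurable
            exact this.enorm.const_mul 2
      _ = 2 * ∫⁻ t, ‖s t - g t‖ₑ ∂ν := by
          rw [lintegral_const_mul' _ _ (by norm_num)]
      _ ≤ 2 * ENNReal.ofReal (ε / 2) := by gcongr
      _ = ENNReal.ofReal ε := by
          rw [← ENNReal.ofReal_ofNat, ← ENNReal.ofReal_mul (by norm_num)]
          congr 1; ring
  have hn : ‖∫ t, B t (s t) - B t (Ψ t) ∂μ‖ₑ ≤ ENNReal.ofReal ε :=
    (enorm_integral_le_lintegral_enorm _).trans hle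
  rw [integral_sub i1 i2, ← ofReal_norm, ENNReal.ofReal_le_ofReal_iff hε.le] at hn
  have := (le_abs_self _).trans hn
  linarith

/-- The integral of the norms of a weakly-* measurable field of functionals is controlled by its
action on continuous fields of vectors in the unit ball. -/
theorem lintegral_enorm_clm_le {B : T → V →L[ℝ] ℝ}
    (hB : ∀ f, AEStronglyMeasurable (fun t => B t f) μ) (hfin : ∫⁻ t, ‖B t‖ₑ ∂μ ≠ ⊤) {L : ℝ≥0∞}
    (hL : ∀ Ψ : C(T, V), (∀ t, ‖Ψ t‖ ≤ 1) → ENNReal.ofReal (∫ t, B t (Ψ t) ∂μ) ≤ L) :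
    ∫⁻ t, ‖B t‖ₑ ∂μ ≤ L := by
  rcases eq_or_ne L ⊤ with rfl | hLtop
  · exact le_top
  obtain ⟨f, hf1, hf⟩ := exists_seq_opNorm_eq_iSup V
  -- Partial suprema increase with N, so monotone convergence applies, and each involves finitely
  -- many vectors, so a simple field attains it.
  have hsup : ∀ t, ‖B t‖ₑ = ⨆ N, ⨆ k, ⨆ (_ : k < N), ENNReal.ofReal (B t (f k)) := by
    intro t
    rw [hf]
    refine le_antisymm (iSup_le fun k => ?_) (iSup_le fun N => iSup₂_le fun k _ =>
      le_iSup (fun k => ENNReal.ofReal (B t (f k))) k)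
    exact le_iSup_of_le (k + 1) (le_iSup₂_of_le k (Nat.lt_succ_self k) le_rfl)
  simp_rw [hsup]
  rw [lintegral_iSup']
  · refine iSup_le fun N => ?_
    obtain ⟨s, hs1, hs⟩ := exists_simpleFunc_maximizing hB hf1 N
    have i1 := integrable_clm_apply hB hfin s.stronglyMeasurable.aestronglyMeasurable hs1
    calc ∫⁻ t, ⨆ k, ⨆ (_ : k < N), ENNReal.ofReal (B t (f k)) ∂μ
        ≤ ∫⁻ t, ENNReal.ofReal (B t (s t)) ∂μ := by
          refine lintegral_mono_ae ?_
          filter_upwards [hs] with t ht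
          exact iSup₂_le fun k hk => ENNReal.ofReal_le_ofReal (ht.2 k hk)
      _ = ENNReal.ofReal (∫ t, B t (s t) ∂μ) :=
          (ofReal_integral_eq_lintegral_ofReal i1 (hs.mono fun t ht => ht.1)).symm
      _ ≤ L := by
          refine ENNReal.ofReal_le_of_le_toReal (le_of_forall_pos_le_add fun ε hε => ?_)
          obtain ⟨Ψ, hΨ, hle⟩ := exists_continuous_integral_clm_le hB hfin s hs1 hε
          have := (ENNReal.ofReal_le_iff_le_toReal hLtop).1 (hL Ψ hΨ)
          linarith
  · intro N
    exact AEMeasurable.iSup fun k => AEMeasurable.iSup fun _ =>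
      (hB (f k)).aemeasurable.ennreal_ofReal
  · refine Eventually.of_forall fun t N M hNM => ?_
    exact iSup₂_le fun k hk => le_iSup₂_of_le k (hk.trans_le hNM) le_rfl

end Duality

/-! ### Polar decomposition of vector measures. -/

section Polar

variable {d : ℕ} {X : Type*} [MeasurableSpace X]

/-- The `i`-th coordinate of a vector measure. -/
def coordMeasure (q : VectorMeasure X (EuclideanSpace ℝ (Fin d))) (i : Fin d) : SignedMeasure X :=
  q.mapRange (EuclideanSpace.proj (𝕜 := ℝ) i : EuclideanSpace ℝ (Fin d) →L[ℝ] ℝ).toAddMonoidHom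
    (EuclideanSpace.proj (𝕜 := ℝ) i : EuclideanSpace ℝ (Fin d) →L[ℝ] ℝ).continuous

lemma coordMeasure_apply (q : VectorMeasure X (EuclideanSpace ℝ (Fin d))) (i : Fin d) (s : Set X) :
    coordMeasure q i s = q s i := rfl

/-- In finite dimension the variation is dominated by the sum of the total variations of the
coordinates, each of which is finite. -/
instance isFiniteMeasure_variation (q : VectorMeasure X (EuclideanSpace ℝ (Fin d))) :
    IsFiniteMeasure q.variation := by
  have h : q.variation ≤ ∑ i, (coordMeasure q i).totalVariation := by
    refine VectorMeasure.variation_le_of_forall_enorm_le fun s _ => ?_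
    calc ‖q s‖ₑ ≤ ∑ i, ‖q s i‖ₑ := by
          have : q s = ∑ i, EuclideanSpace.single i (q s i) := by
            ext j
            simp [Finset.sum_apply]
          conv_lhs => rw [this]
          refine (enorm_sum_le _ _).trans (Finset.sum_le_sum fun i _ => ?_)
          rw [← ofReal_norm, ← ofReal_norm]
          simp
      _ ≤ ∑ i, (coordMeasure q i).totalVariation s := by
          refine Finset.sum_le_sum fun i _ => ?_
          exact SignedMeasure.enorm_le_totalVariation (coordMeasure q i) s
      _ = (∑ i, (coordMeasure q i).totalVariation) s := by simp
  have : IsFiniteMeasure (∑ i, (coordMeasure q i).totalVariation) := by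
    refine ⟨?_⟩
    simp only [Measure.coe_finsetSum, Finset.sum_apply]
    refine ENNReal.sum_lt_top.2 fun i _ => ?_
    simp only [SignedMeasure.totalVariation, Measure.add_apply]
    exact ENNReal.add_lt_top.2 ⟨measure_lt_top _ _, measure_lt_top _ _⟩
  exact isFiniteMeasure_of_le _ h

/-- Polar decomposition of a vector measure. -/
theorem exists_polar (q : VectorMeasure X (EuclideanSpace ℝ (Fin d))) :
    ∃ u : X → EuclideanSpace ℝ (Fin d), Integrable u q.variation ∧
      q = q.variation.withDensityᵥ u ∧ ∀ᵐ x ∂q.variation, ‖u x‖ = 1 := by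
  have hac : ∀ i, coordMeasure q i ≪ᵥ q.variation.toENNRealVectorMeasure := by
    intro i
    refine VectorMeasure.AbsolutelyContinuous.mk fun s hs h0 => ?_
    rw [Measure.toENNRealVectorMeasure_apply_measurable hs] at h0
    have : q s = 0 := by
      have := VectorMeasure.enorm_measure_le_variation q s
      rw [h0] at this
      simpa using this
    rw [coordMeasure_apply, this]
    rfl
  let u : X → EuclideanSpace ℝ (Fin d) :=
    fun x => WithLp.toLp 2 fun i => (coordMeasure q i).rnDeriv q.variation x
  have hu : Integrable u q.variation := by
    have : u = fun x =>
        ∑ i, EuclideanSpace.single i ((coordMeasure q i).rnDeriv q.variation x) := by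
      ext x j
      simp [u, Finset.sum_apply]
    rw [this]
    refine integrable_finsetSum _ fun i _ => ?_
    have hi : Integrable ((coordMeasure q i).rnDeriv q.variation) q.variation :=
      SignedMeasure.integrable_rnDeriv _ _
    have := hi.smul_const (EuclideanSpace.single i (1 : ℝ))
    refine this.congr (Eventually.of_forall fun x => ?_)
    ext j
    by_cases h : j = i <;> simp [h]
  have hq : q = q.variation.withDensityᵥ u := by
    ext s hs i
    rw [withDensityᵥ_apply hu hs]
    have h1 := (EuclideanSpace.proj (𝕜 := ℝ) i :
      EuclideanSpace ℝ (Fin d) →L[ℝ] ℝ).integral_comp_comm (hu.restrict (s := s))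
    have h2 := SignedMeasure.withDensityᵥ_rnDeriv_eq _ _ (hac i)
    have h3 : (q.variation.withDensityᵥ ((coordMeasure q i).rnDeriv q.variation)) s = q s i := by
      rw [h2]; rfl
    rw [withDensityᵥ_apply (SignedMeasure.integrable_rnDeriv _ _) hs] at h3
    rw [← h3]
    exact h1
  refine ⟨u, hu, hq, ?_⟩
  -- The variation of u · |q| is ‖u‖ · |q|; as u · |q| = q, uniqueness of densities forces ‖u‖ = 1.
  have hv : q.variation.withDensity (fun x => ‖u x‖ₑ) = q.variation.withDensity 1 := by
    rw [← Measure.variation_withDensityᵥ hu, ← hq, withDensity_one]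
  rw [withDensity_eq_iff hu.aestronglyMeasurable.enorm (by fun_prop) hu.2.ne] at hv
  filter_upwards [hv] with x hx
  have : ‖u x‖ₑ = 1 := hx
  rw [← toReal_enorm, this]
  simp

end Polar

/-! ### Vector measures as functionals; weighted mass as a dual norm. -/

section Pairing

variable {d : ℕ} {Ω : Set (EuclideanSpace ℝ (Fin d))}

/-- Both sides are additive, agree on indicators, and are continuous on L¹(|q|), the right one being
1-Lipschitz because ‖u‖ = 1. -/
lemma pairing_eq_integral_inner {q : VectorMeasure Ω (EuclideanSpace ℝ (Fin d))}
    {u : Ω → EuclideanSpace ℝ (Fin d)} (hu : Integrable u q.variation)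
    (hq : q = q.variation.withDensityᵥ u) (hu1 : ∀ᵐ x ∂q.variation, ‖u x‖ = 1)
    {f : Ω → EuclideanSpace ℝ (Fin d)} (hf : Integrable f q.variation) :
    pairing f q = ∫ x, inner ℝ (f x) (u x) ∂q.variation := by
  have hinteg : ∀ f : Ω → EuclideanSpace ℝ (Fin d), Integrable f q.variation →
      Integrable (fun x => inner ℝ (f x) (u x)) q.variation := by
    intro f hf
    refine hf.norm.mono' (hf.aestronglyMeasurable.inner hu.aestronglyMeasurable) ?_
    filter_upwards [hu1] with x hx
    exact (norm_inner_le_norm _ _).trans (by rw [hx, mul_one])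
  unfold pairing
  refine Integrable.induction (μ := q.variation)
    (fun f => ∫ᵛ x, f x ∂[innerSL ℝ; q] = ∫ x, inner ℝ (f x) (u x) ∂q.variation)
    (fun c s hs _ => ?_) (fun f g _ hf hg ef eg => ?_) ?_ (fun f g hfg _ ef => ?_) hf
  · have hqs : q s = ∫ x in s, u x ∂q.variation := by
      conv_lhs => rw [hq]
      exact withDensityᵥ_apply hu hs
    have : ∀ x, inner ℝ (s.indicator (fun _ => c) x) (u x)
        = s.indicator (fun x => inner ℝ c (u x)) x := by
      intro x
      by_cases h : x ∈ s <;> simp [h]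
    simp_rw [this]
    rw [VectorMeasure.integral_indicator hs, VectorMeasure.integral_const,
      VectorMeasure.restrict_apply _ hs MeasurableSet.univ, Set.univ_inter,
      integral_indicator hs, integral_inner hu.restrict, hqs]
    rfl
  · rw [VectorMeasure.integral_add hf hg, ef, eg, ← integral_add (hinteg _ hf) (hinteg _ hg)]
    simp [inner_add_left]
  · refine isClosed_eq VectorMeasure.continuous_integral ?_
    refine (LipschitzWith.of_dist_le_mul (K := 1) fun f g => ?_).continuous
    have hf := L1.integrable_coeFn f
    have hg := L1.integrable_coeFn g
    rw [dist_eq_norm, ← integral_sub (hinteg _ hf) (hinteg _ hg), dist_eq_norm,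
      L1.norm_sub_eq_lintegral, NNReal.coe_one, one_mul]
    refine (norm_integral_le_integral_norm _).trans ?_
    have e := integral_norm_eq_lintegral_enorm (hf.sub hg).aestronglyMeasurable
    simp only [Pi.sub_apply] at e
    rw [← e]
    refine integral_mono_ae ((hinteg _ hf).sub (hinteg _ hg)).norm (hf.sub hg).norm ?_
    filter_upwards [hu1] with x hx
    rw [← inner_sub_left]
    exact (norm_inner_le_norm _ _).trans (by rw [hx, mul_one])
  · rw [VectorMeasure.integral_congr_ae hfg.symm, ef]
    refine integral_congr_ae ?_
    filter_upwards [hfg] with x hx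
    rw [hx]

lemma enorm_pairing_le (f : Ω → EuclideanSpace ℝ (Fin d))
    (q : VectorMeasure Ω (EuclideanSpace ℝ (Fin d))) :
    ‖pairing f q‖ₑ ≤ ∫⁻ x, ‖f x‖ₑ ∂q.variation := by
  refine VectorMeasure.enorm_integral_le_lintegral_enorm.trans ?_
  refine mul_le_of_le_one_left' ?_
  rw [← ofReal_norm]
  exact ENNReal.ofReal_le_one.2 (norm_innerSL_le ℝ)

lemma integrable_variation_of_continuous [CompactSpace Ω]
    (q : VectorMeasure Ω (EuclideanSpace ℝ (Fin d))) {V : Type*} [NormedAddCommGroup V]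
    [SecondCountableTopology V] (f : C(Ω, V)) : Integrable f q.variation :=
  Integrable.of_bound f.continuous.stronglyMeasurable.aestronglyMeasurable ‖f‖
    (Eventually.of_forall f.norm_coe_le_norm)

lemma norm_pairing_le [CompactSpace Ω] (f : C(Ω, EuclideanSpace ℝ (Fin d)))
    (q : VectorMeasure Ω (EuclideanSpace ℝ (Fin d))) :
    ‖pairing f q‖ ≤ q.variation.real Set.univ * ‖f‖ := by
  have h := enorm_pairing_le f q
  rw [← ENNReal.ofReal_le_ofReal_iff (by positivity), ofReal_norm]
  refine h.trans ((lintegral_mono fun x => ?_).trans_eq (lintegral_const ‖f‖ₑ) |>.trans_eq ?_)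
  · rw [← ofReal_norm, ← ofReal_norm]
    exact ENNReal.ofReal_le_ofReal (f.norm_coe_le_norm x)
  · rw [mul_comm, ENNReal.ofReal_mul measureReal_nonneg, ofReal_norm, ofReal_measureReal]

/-- A vector measure as a functional on continuous vector fields. -/
def pairingCLM [CompactSpace Ω] (q : VectorMeasure Ω (EuclideanSpace ℝ (Fin d))) :
    C(Ω, EuclideanSpace ℝ (Fin d)) →L[ℝ] ℝ :=
  LinearMap.mkContinuous
    { toFun := fun f => pairing f q
      map_add' := fun f g => VectorMeasure.integral_fun_add
        (integrable_variation_of_continuous q f) (integrable_variation_of_continuous q g)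
      map_smul' := fun c f => VectorMeasure.integral_fun_smul q _ c f }
    (q.variation.real Set.univ) fun f => norm_pairing_le f q

/-- The vector measure with continuous scalar density `w` with respect to `q`, as a functional on
continuous vector fields. -/
def weightedPairing [CompactSpace Ω] (w : C(Ω, ℝ))
    (q : VectorMeasure Ω (EuclideanSpace ℝ (Fin d))) : C(Ω, EuclideanSpace ℝ (Fin d)) →L[ℝ] ℝ :=
  LinearMap.mkContinuous
    { toFun := fun f => pairingCLM q (w • f)
      map_add' := fun f g => by
        rw [← map_add]
        congr 1
        ext x : 1
        exact smul_add _ _ _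
      map_smul' := fun c f => by
        rw [RingHom.id_apply, ← map_smul]
        congr 1
        ext x : 1
        exact smul_comm (w x) c (f x) }
    (‖pairingCLM q‖ * ‖w‖) fun f => by
      refine ((pairingCLM q).le_opNorm _).trans ?_
      rw [mul_assoc]
      gcongr
      refine (ContinuousMap.norm_le _ (by positivity)).2 fun x => ?_
      rw [ContinuousMap.smul_apply', norm_smul]
      exact mul_le_mul (w.norm_coe_le_norm x) (f.norm_coe_le_norm x) (norm_nonneg _) (norm_nonneg _)

/-- The mass of `w q` is the norm of the corresponding functional. -/
theorem lintegral_variation_eq_enorm [CompactSpace Ω] {w : C(Ω, ℝ)} (hw : ∀ x, 0 ≤ w x)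
    (q : VectorMeasure Ω (EuclideanSpace ℝ (Fin d))) :
    ∫⁻ x, ENNReal.ofReal (w x) ∂q.variation = ‖weightedPairing w q‖ₑ := by
  have hwi := integrable_variation_of_continuous q w
  rw [← ofReal_integral_eq_lintegral_ofReal hwi (Eventually.of_forall hw), ← ofReal_norm]
  congr 1
  refine le_antisymm ?_ ?_
  · obtain ⟨u, hu, hq, hu1⟩ := exists_polar q
    refine le_of_forall_pos_le_add fun ε hε => ?_
    have hW : 0 < 2 * ‖w‖ + 1 := by positivity
    -- The optimal test field is u itself. A truncated continuous approximation of it loses at most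
    -- 2‖w‖ times the L¹ error; the extra 1 in the denominator allows w = 0.
    obtain ⟨g, hg, hgi⟩ := hu.exists_boundedContinuous_integral_sub_le (div_pos hε hW)
    let Φ : C(Ω, EuclideanSpace ℝ (Fin d)) :=
      ⟨fun x => radialTrunc (g x), continuous_radialTrunc.comp g.continuous⟩
    have hΦ : ‖Φ‖ ≤ 1 :=
      (ContinuousMap.norm_le _ zero_le_one).2 fun x => norm_radialTrunc_le (g x)
    have hfi := integrable_variation_of_continuous q (w • Φ)
    have h1 : pairing (w • Φ : C(Ω, EuclideanSpace ℝ (Fin d))) q ≤ ‖weightedPairing w q‖ := by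
      calc pairing (w • Φ : C(Ω, EuclideanSpace ℝ (Fin d))) q
          = weightedPairing w q Φ := rfl
        _ ≤ ‖weightedPairing w q Φ‖ := le_abs_self _
        _ ≤ ‖weightedPairing w q‖ * ‖Φ‖ := ContinuousLinearMap.le_opNorm _ _
        _ ≤ ‖weightedPairing w q‖ := mul_le_of_le_one_right (ContinuousLinearMap.opNorm_nonneg _) hΦ
    have h2 : ∫ x, w x ∂q.variation
        ≤ ∫ x, (inner ℝ ((w • Φ) x) (u x) + 2 * ‖w‖ * ‖u x - g x‖) ∂q.variation := by
      have hin : Integrable (fun x => inner ℝ ((w • Φ) x) (u x)) q.variation := by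
        refine hfi.norm.mono' (hfi.aestronglyMeasurable.inner hu.aestronglyMeasurable) ?_
        filter_upwards [hu1] with x hx
        exact (norm_inner_le_norm _ _).trans (by rw [hx, mul_one])
      refine integral_mono_ae hwi (hin.add ((hu.sub hgi).norm.const_mul _)) ?_
      filter_upwards [hu1] with x hx
      have e : w x - inner ℝ ((w • Φ) x) (u x) = w x * inner ℝ (u x - Φ x) (u x) := by
        rw [ContinuousMap.smul_apply', inner_sub_left, real_inner_smul_left,
          real_inner_self_eq_norm_sq, hx]
        ring
      have e2 : inner ℝ (u x - Φ x) (u x) ≤ 2 * ‖u x - g x‖ := by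
        refine (real_inner_le_norm _ _).trans ?_
        rw [hx, mul_one]
        exact norm_sub_radialTrunc_le hx.le _
      have e3 : w x * inner ℝ (u x - Φ x) (u x) ≤ ‖w‖ * (2 * ‖u x - g x‖) := by
        refine (mul_le_mul_of_nonneg_left e2 (hw x)).trans ?_
        gcongr
        exact (le_abs_self _).trans (w.norm_coe_le_norm x)
      change w x ≤ inner ℝ ((w • Φ) x) (u x) + 2 * ‖w‖ * ‖u x - g x‖
      linarith
    have h3 : ∫ x, (inner ℝ ((w • Φ) x) (u x) + 2 * ‖w‖ * ‖u x - g x‖) ∂q.variation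
        = pairing (w • Φ : C(Ω, EuclideanSpace ℝ (Fin d))) q
          + 2 * ‖w‖ * ∫ x, ‖u x - g x‖ ∂q.variation := by
      rw [pairing_eq_integral_inner hu hq hu1 hfi, ← integral_const_mul, integral_add]
      · refine hfi.norm.mono' (hfi.aestronglyMeasurable.inner hu.aestronglyMeasurable) ?_
        filter_upwards [hu1] with x hx
        exact (norm_inner_le_norm _ _).trans (by rw [hx, mul_one])
      · exact (hu.sub hgi).norm.const_mul _
    have h4 : 2 * ‖w‖ * ∫ x, ‖u x - g x‖ ∂q.variation ≤ ε := by
      calc 2 * ‖w‖ * ∫ x, ‖u x - g x‖ ∂q.variation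
          ≤ (2 * ‖w‖ + 1) * (ε / (2 * ‖w‖ + 1)) := by
            gcongr
            linarith
        _ = ε := mul_div_cancel₀ _ hW.ne'
    linarith
  · refine ContinuousLinearMap.opNorm_le_bound _ (integral_nonneg hw) fun f => ?_
    rw [← ENNReal.ofReal_le_ofReal_iff (mul_nonneg (integral_nonneg hw) (norm_nonneg _)),
      ofReal_norm, ENNReal.ofReal_mul (integral_nonneg hw),
      ofReal_integral_eq_lintegral_ofReal hwi (Eventually.of_forall hw),
      ← lintegral_mul_const' _ _ ENNReal.ofReal_ne_top]
    refine (enorm_pairing_le _ q).trans (lintegral_mono fun x => ?_)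
    rw [← ENNReal.ofReal_mul (hw x), ← ofReal_norm, ContinuousMap.smul_apply', norm_smul,
      Real.norm_of_nonneg (hw x)]
    exact ENNReal.ofReal_le_ofReal (mul_le_mul_of_nonneg_left (f.norm_coe_le_norm x) (hw x))

end Pairing

/-! ### F as a weighted total variation of the flux. -/

section Representation

variable {d : ℕ} {Ω : Set (EuclideanSpace ℝ (Fin d))} {α : ℝ}

/-- The flux weighted by the mass of the atoms of `ρ` to the power `α - 1`. This is `+∞` unless the
flux is concentrated on the atoms of `ρ`. -/
def atomicCost (α : ℝ) (ρ : ProbabilityMeasure Ω)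
    (q : VectorMeasure Ω (EuclideanSpace ℝ (Fin d))) : ℝ≥0∞ :=
  ∫⁻ x, (ρ : Measure Ω) {x} ^ (α - 1) ∂q.variation

lemma withDensity_singleton {X : Type*} [MeasurableSpace X] [MeasurableSingletonClass X]
    (μ : Measure X) (f : X → ℝ≥0∞) (x : X) : μ.withDensity f {x} = f x * μ {x} := by
  rw [withDensity_apply _ (measurableSet_singleton x), lintegral_singleton]

lemma ennreal_rpow_le_rpow_of_nonpos {z : ℝ} (hz : z ≤ 0) {a b : ℝ≥0∞} (h : a ≤ b) :
    b ^ z ≤ a ^ z := by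
  rw [← neg_neg z, ENNReal.rpow_neg b, ENNReal.rpow_neg a]
  exact ENNReal.inv_le_inv.2 (ENNReal.rpow_le_rpow h (by linarith))

/-- The pointwise identity behind the representation of F, with a = ‖v x‖ and r = ρ({x}). At r = 0
the right side is ⊤ * 0 = 0 when α < 1. -/
lemma mul_rpow_atom (hα_pos : 0 < α) {a r : ℝ≥0∞} (hr : r ≠ ⊤) :
    (a ^ (1 / α) * r) ^ α = r ^ (α - 1) * (a * r) := by
  rw [ENNReal.mul_rpow_of_nonneg _ _ hα_pos.le, ← ENNReal.rpow_mul, one_div_mul_cancel hα_pos.ne',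
    ENNReal.rpow_one]
  rcases eq_or_ne r 0 with rfl | h0
  · simp [ENNReal.zero_rpow_of_pos hα_pos]
  · have : r ^ α = r ^ (α - 1) * r := by
      conv_rhs => rw [← ENNReal.rpow_one r, ← ENNReal.rpow_mul, one_mul,
        ← ENNReal.rpow_add _ _ h0 hr, sub_add_cancel]
    rw [this]
    ring

lemma countable_atoms (ρ : ProbabilityMeasure Ω) : {x | (ρ : Measure Ω) {x} ≠ 0}.Countable := by
  have := Measure.countable_meas_pos_of_disjoint_iUnion (μ := (ρ : Measure Ω))
    (As := fun x : Ω => {x}) (fun x => measurableSet_singleton x)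
    (fun x y h => by simpa using h)
  simpa [pos_iff_ne_zero] using this

lemma atomicCost_le_F (hα_pos : 0 < α) (ρ : ProbabilityMeasure Ω)
    (q : VectorMeasure Ω (EuclideanSpace ℝ (Fin d))) : atomicCost α ρ q ≤ F α ρ q := by
  refine le_iInf fun v => le_iInf fun hv => le_iInf fun hq => ?_
  subst hq
  rw [atomicCost, Measure.variation_withDensityᵥ hv, G]
  split_ifs with hat
  swap
  · exact le_top
  obtain ⟨S, hS, h0⟩ := hat
  have hvm : AEMeasurable (fun x => ‖v x‖ₑ) (ρ : Measure Ω) := hv.aestronglyMeasurable.enorm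
  -- The densities ‖v‖ and ‖v‖^(1/α) vanish at the same points, so the two measures have the same
  -- null sets.
  have h1 : (ρ : Measure Ω).withDensity (fun x => ‖v x‖ₑ) Sᶜ = 0 := by
    rw [withDensity_apply_eq_zero' (hvm.pow_const _)] at h0
    rw [withDensity_apply_eq_zero' hvm]
    convert h0 using 4 with x
    simp [ENNReal.rpow_eq_zero_iff, hα_pos]
  calc ∫⁻ x, (ρ : Measure Ω) {x} ^ (α - 1) ∂(ρ : Measure Ω).withDensity (fun x => ‖v x‖ₑ)
      = ∫⁻ x in S, (ρ : Measure Ω) {x} ^ (α - 1)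
          ∂(ρ : Measure Ω).withDensity (fun x => ‖v x‖ₑ) := by
        rw [Measure.restrict_eq_self_of_ae_mem (mem_ae_iff.2 h1)]
    _ = ∑' x : S, (ρ : Measure Ω) {(x : Ω)} ^ (α - 1) * (‖v x‖ₑ * (ρ : Measure Ω) {(x : Ω)}) := by
        rw [lintegral_countable _ hS]
        simp_rw [withDensity_singleton]
    _ = ∑' x : S, (fun x =>
          ((ρ : Measure Ω).withDensity (fun x => ‖v x‖ₑ ^ (1 / α))) {x} ^ α) x := by
        refine tsum_congr fun x => ?_
        beta_reduce
        rw [withDensity_singleton, mul_rpow_atom hα_pos (measure_ne_top _ _)]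
    _ ≤ ∑' x, ((ρ : Measure Ω).withDensity (fun x => ‖v x‖ₑ ^ (1 / α))) {x} ^ α :=
        ENNReal.tsum_comp_le_tsum_of_injective Subtype.val_injective _

/-- Off the atoms the weight is 0^(α-1) = ⊤, so any flux there would make the cost infinite. -/
lemma variation_compl_atoms {ρ : ProbabilityMeasure Ω} (hα_lt_one : α < 1)
    {q : VectorMeasure Ω (EuclideanSpace ℝ (Fin d))} (h : atomicCost α ρ q ≠ ⊤) :
    q.variation {x | (ρ : Measure Ω) {x} ≠ 0}ᶜ = 0 := by
  by_contra h0
  refine h (top_le_iff.1 ?_)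
  have hm : MeasurableSet {x | (ρ : Measure Ω) {x} ≠ 0}ᶜ := (countable_atoms ρ).measurableSet.compl
  calc ⊤ = ∫⁻ x in {x | (ρ : Measure Ω) {x} ≠ 0}ᶜ, (⊤ : ℝ≥0∞) ∂q.variation := by
        rw [setLIntegral_const, ENNReal.top_mul h0]
    _ ≤ ∫⁻ x in {x | (ρ : Measure Ω) {x} ≠ 0}ᶜ, (ρ : Measure Ω) {x} ^ (α - 1) ∂q.variation := by
        refine setLIntegral_mono' hm fun x hx => ?_
        have hx : (ρ : Measure Ω) {x} = 0 := not_not.1 hx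
        rw [hx, ENNReal.zero_rpow_of_neg (by linarith)]
    _ ≤ atomicCost α ρ q := setLIntegral_le_lintegral _ _

lemma isPurelyAtomic_variation {ρ : ProbabilityMeasure Ω} (hα_lt_one : α < 1)
    {q : VectorMeasure Ω (EuclideanSpace ℝ (Fin d))} (h : atomicCost α ρ q ≠ ⊤) :
    IsPurelyAtomic q.variation :=
  ⟨_, countable_atoms ρ, variation_compl_atoms hα_lt_one h⟩

lemma variation_absolutelyContinuous {ρ : ProbabilityMeasure Ω} (hα_lt_one : α < 1)
    {q : VectorMeasure Ω (EuclideanSpace ℝ (Fin d))} (h : atomicCost α ρ q ≠ ⊤) :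
    q.variation ≪ (ρ : Measure Ω) := by
  refine fun s hs => measure_mono_null (fun x hx => ?_) (variation_compl_atoms hα_lt_one h)
  exact not_not.2 (measure_mono_null (Set.singleton_subset_iff.2 hx) hs)

lemma absolutelyContinuous_of_atomicCost_ne_top {ρ : ProbabilityMeasure Ω} (hα_lt_one : α < 1)
    {q : VectorMeasure Ω (EuclideanSpace ℝ (Fin d))} (h : atomicCost α ρ q ≠ ⊤) :
    q ≪ᵥ (ρ : Measure Ω).toENNRealVectorMeasure := by
  refine VectorMeasure.AbsolutelyContinuous.mk fun s hs h0 => ?_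
  rw [Measure.toENNRealVectorMeasure_apply_measurable hs] at h0
  have := VectorMeasure.enorm_measure_le_variation q s
  rw [variation_absolutelyContinuous hα_lt_one h h0] at this
  simpa using this

/-- If the right side is finite, |q| lives on the atoms of ρ and so is absolutely continuous. The
polar direction times d|q|/dρ is then an admissible density, and its cost is a sum over atoms. -/
lemma F_le_atomicCost (hα_pos : 0 < α) (hα_lt_one : α < 1) (ρ : ProbabilityMeasure Ω)
    (q : VectorMeasure Ω (EuclideanSpace ℝ (Fin d))) : F α ρ q ≤ atomicCost α ρ q := by
  rcases eq_or_ne (atomicCost α ρ q) ⊤ with h | h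
  · rw [h]; exact le_top
  have hac := variation_absolutelyContinuous hα_lt_one h
  obtain ⟨u, hu, hq, -⟩ := exists_polar q
  let v : Ω → EuclideanSpace ℝ (Fin d) :=
    fun x => (q.variation.rnDeriv (ρ : Measure Ω) x).toReal • u x
  have hv : Integrable v (ρ : Measure Ω) := (integrable_rnDeriv_smul_iff hac).2 hu
  have hqv : q = (ρ : Measure Ω).withDensityᵥ v := by
    conv_lhs => rw [hq]
    exact (withDensityᵥ_rnDeriv_smul hac hu).symm
  have hvar : q.variation = (ρ : Measure Ω).withDensity fun x => ‖v x‖ₑ := by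
    conv_lhs => rw [hqv]
    exact Measure.variation_withDensityᵥ hv
  refine iInf_le_of_le v (iInf_le_of_le hv (iInf_le_of_le hqv ?_))
  have hvm : AEMeasurable (fun x => ‖v x‖ₑ) (ρ : Measure Ω) := hv.aestronglyMeasurable.enorm
  have hat : IsPurelyAtomic ((ρ : Measure Ω).withDensity fun x => ‖v x‖ₑ ^ (1 / α)) := by
    refine ⟨_, countable_atoms ρ, ?_⟩
    have h0 := variation_compl_atoms hα_lt_one h
    rw [hvar, withDensity_apply_eq_zero' hvm] at h0
    rw [withDensity_apply_eq_zero' (hvm.pow_const _)]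
    convert h0 using 4 with x
    simp [ENNReal.rpow_eq_zero_iff, hα_pos]
  rw [G, if_pos hat]
  have hterm : ∀ x, (ρ : Measure Ω).withDensity (fun x => ‖v x‖ₑ ^ (1 / α)) {x} ^ α
      = (ρ : Measure Ω) {x} ^ (α - 1) * q.variation {x} := by
    intro x
    rw [withDensity_singleton, mul_rpow_atom hα_pos (measure_ne_top _ _), hvar,
      withDensity_singleton]
  simp_rw [hterm]
  calc ∑' x, (ρ : Measure Ω) {x} ^ (α - 1) * q.variation {x}
      = ∑' x : {x | (ρ : Measure Ω) {x} ≠ 0},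
          (ρ : Measure Ω) {(x : Ω)} ^ (α - 1) * q.variation {(x : Ω)} := by
        refine (tsum_subtype_eq_of_support_subset fun x hx => ?_).symm
        by_contra h0
        have h0 : (ρ : Measure Ω) {x} = 0 := not_not.1 h0
        exact hx (by beta_reduce; rw [hac h0, mul_zero])
    _ = ∫⁻ x in {x | (ρ : Measure Ω) {x} ≠ 0}, (ρ : Measure Ω) {x} ^ (α - 1) ∂q.variation :=
        (lintegral_countable (fun x => (ρ : Measure Ω) {x} ^ (α - 1)) (countable_atoms ρ)).symm
    _ ≤ atomicCost α ρ q := setLIntegral_le_lintegral _ _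

lemma variation_le_atomicCost (hα_lt_one : α < 1) (ρ : ProbabilityMeasure Ω)
    (q : VectorMeasure Ω (EuclideanSpace ℝ (Fin d))) : q.variation Set.univ ≤ atomicCost α ρ q := by
  rw [← lintegral_one]
  refine lintegral_mono fun x => ?_
  simpa using ennreal_rpow_le_rpow_of_nonpos (z := α - 1) (by linarith)
    (prob_le_one (μ := (ρ : Measure Ω)) (s := {x}))

end Representation

/-! ### Bounded distributional derivative implies Lipschitz. -/

section WeakDerivative

/-- A smooth step from `0` to `1` across the interval `[a, a + ε]`. -/
def smoothStep (ε a x : ℝ) : ℝ := Real.smoothTransition ((x - a) / ε)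

variable {ε a : ℝ}

lemma contDiff_smoothStep (ε a : ℝ) : ContDiff ℝ ∞ (smoothStep ε a) :=
  Real.smoothTransition.contDiff.comp ((contDiff_id.sub contDiff_const).div_const ε)

lemma monotone_smoothStep (hε : 0 < ε) : Monotone (smoothStep ε a) := fun x y h =>
  Real.smoothTransition.monotone (by gcongr)

lemma smoothStep_of_le (hε : 0 < ε) {x : ℝ} (hx : x ≤ a) : smoothStep ε a x = 0 :=
  Real.smoothTransition.zero_of_nonpos (div_nonpos_of_nonpos_of_nonneg (by linarith) hε.le)

lemma smoothStep_of_ge (hε : 0 < ε) {x : ℝ} (hx : a + ε ≤ x) : smoothStep ε a x = 1 :=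
  Real.smoothTransition.one_of_one_le ((one_le_div hε).2 (by linarith))

lemma deriv_smoothStep_eq_zero (hε : 0 < ε) {x : ℝ} (hx : x ∉ Set.Icc a (a + ε)) :
    deriv (smoothStep ε a) x = 0 := by
  rw [Set.mem_Icc, not_and_or, not_le, not_le] at hx
  rcases hx with hx | hx
  · have : smoothStep ε a =ᶠ[𝓝 x] fun _ => 0 := by
      filter_upwards [Iio_mem_nhds hx] with y hy using smoothStep_of_le hε (le_of_lt hy)
    rw [this.deriv_eq, deriv_const]
  · have : smoothStep ε a =ᶠ[𝓝 x] fun _ => 1 := by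
      filter_upwards [Ioi_mem_nhds hx] with y hy using smoothStep_of_ge hε (le_of_lt hy)
    rw [this.deriv_eq, deriv_const]

lemma continuous_deriv_smoothStep : Continuous (deriv (smoothStep ε a)) :=
  (contDiff_smoothStep ε a).continuous_deriv (by simp)

lemma integral_deriv_smoothStep (hε : 0 < ε) (h0 : 0 ≤ a) (h1 : a + ε ≤ 1) :
    ∫ x in (0 : ℝ)..1, deriv (smoothStep ε a) x = 1 := by
  rw [intervalIntegral.integral_deriv_eq_sub
    (fun x _ => (contDiff_smoothStep ε a).differentiable (by simp) x)
    (continuous_deriv_smoothStep.intervalIntegrable _ _), smoothStep_of_ge hε h1,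
    smoothStep_of_le hε h0, sub_zero]

/-- The derivative of the step is a probability density supported in [a, a + ε], so the integral is
an average of h near a. -/
lemma abs_integral_deriv_smoothStep_mul_sub_le {h : ℝ → ℝ} (hh : Continuous h) (hε : 0 < ε)
    (h0 : 0 ≤ a) (h1 : a + ε ≤ 1) {η : ℝ} (hη : ∀ x ∈ Set.Icc a (a + ε), |h x - h a| ≤ η) :
    |(∫ x in (0 : ℝ)..1, deriv (smoothStep ε a) x * h x) - h a| ≤ η := by
  have i1 : IntervalIntegrable (fun x => deriv (smoothStep ε a) x * h x) volume 0 1 :=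
    (continuous_deriv_smoothStep.mul hh).intervalIntegrable _ _
  have i2 : IntervalIntegrable (fun x => deriv (smoothStep ε a) x * h a) volume 0 1 :=
    (continuous_deriv_smoothStep.mul continuous_const).intervalIntegrable _ _
  have e : (∫ x in (0 : ℝ)..1, deriv (smoothStep ε a) x * h x) - h a
      = ∫ x in (0 : ℝ)..1, deriv (smoothStep ε a) x * (h x - h a) := by
    simp_rw [mul_sub]
    rw [intervalIntegral.integral_sub i1 i2, intervalIntegral.integral_mul_const,
      integral_deriv_smoothStep hε h0 h1, one_mul]
  rw [e, ← Real.norm_eq_abs]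
  have hle : ∀ x ∈ Set.Ioc (0 : ℝ) 1,
      ‖deriv (smoothStep ε a) x * (h x - h a)‖ ≤ deriv (smoothStep ε a) x * η := by
    intro x _
    have hd : 0 ≤ deriv (smoothStep ε a) x := (monotone_smoothStep hε).deriv_nonneg
    rw [norm_mul, Real.norm_of_nonneg hd]
    by_cases hx : x ∈ Set.Icc a (a + ε)
    · exact mul_le_mul_of_nonneg_left (hη x hx) hd
    · simp [deriv_smoothStep_eq_zero hε hx]
  refine (intervalIntegral.norm_integral_le_of_norm_le zero_le_one
    (Eventually.of_forall hle)
    ((continuous_deriv_smoothStep.mul continuous_const).intervalIntegrable _ _)).trans_eq ?_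
  rw [intervalIntegral.integral_mul_const, integral_deriv_smoothStep hε h0 h1, one_mul]

/-- A continuous function whose distributional derivative on `(0, 1)` is bounded by `M` is
`M`-Lipschitz on `[0, 1]`. -/
theorem abs_sub_le_of_weak_derivative_bound {h : ℝ → ℝ} (hh : Continuous h) {M : ℝ} (hM : 0 ≤ M)
    (hw : ∀ χ : ℝ → ℝ, ContDiff ℝ ∞ χ → χ 0 = 0 → χ 1 = 0 →
      |∫ x in (0 : ℝ)..1, deriv χ x * h x| ≤ M * ∫ x in (0 : ℝ)..1, |χ x|)
    {s t : ℝ} (hs : 0 ≤ s) (hst : s ≤ t) (ht : t ≤ 1) : |h t - h s| ≤ M * (t - s) := by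
  have key : ∀ t, s < t → t < 1 → |h t - h s| ≤ M * (t - s) := by
    intro t hst ht
    refine le_of_forall_pos_le_add fun η hη => ?_
    obtain ⟨δ₁, hδ₁, H₁⟩ := Metric.continuous_iff.1 hh s (η / 4) (by positivity)
    obtain ⟨δ₂, hδ₂, H₂⟩ := Metric.continuous_iff.1 hh t (η / 4) (by positivity)
    obtain ⟨ε, hε, hε'⟩ : ∃ ε > 0, ε < min (min δ₁ δ₂) (min (1 - t) (η / (4 * (M + 1)))) :=
      exists_between (lt_min (lt_min hδ₁ hδ₂) (lt_min (by linarith) (by positivity)))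
    rw [lt_min_iff, lt_min_iff, lt_min_iff] at hε'
    obtain ⟨⟨e1, e2⟩, e3, e4⟩ := hε'
    have b1 := abs_integral_deriv_smoothStep_mul_sub_le hh hε hs (by linarith : s + ε ≤ 1)
      (η := η / 4) fun x hx => by
        have := H₁ x (by rw [Real.dist_eq, abs_of_nonneg] <;> linarith [hx.1, hx.2])
        rw [Real.dist_eq] at this
        exact this.le
    have b2 := abs_integral_deriv_smoothStep_mul_sub_le hh hε (by linarith : 0 ≤ t)
      (by linarith : t + ε ≤ 1) (η := η / 4) fun x hx => by
        have := H₂ x (by rw [Real.dist_eq, abs_of_nonneg] <;> linarith [hx.1, hx.2])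
        rw [Real.dist_eq] at this
        exact this.le
    -- A smoothed indicator of [s, t]: its derivative approximates δ_s - δ_t, and its L¹ norm is at
    -- most t - s + ε. The two averaging errors and M ε each cost η / 4.
    let χ : ℝ → ℝ := fun x => smoothStep ε s x - smoothStep ε t x
    have hχ : ContDiff ℝ ∞ χ := (contDiff_smoothStep ε s).sub (contDiff_smoothStep ε t)
    have b3 := hw χ hχ
      (by simp only [χ]; rw [smoothStep_of_le hε hs, smoothStep_of_le hε (by linarith), sub_zero])
      (by simp only [χ]; rw [smoothStep_of_ge hε (by linarith), smoothStep_of_ge hε (by linarith),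
        sub_self])
    have hd : ∀ x, deriv χ x = deriv (smoothStep ε s) x - deriv (smoothStep ε t) x := fun x =>
      deriv_fun_sub ((contDiff_smoothStep ε s).differentiable (by simp) x)
        ((contDiff_smoothStep ε t).differentiable (by simp) x)
    simp_rw [hd, sub_mul] at b3
    have hi : ∀ a, IntervalIntegrable (fun x => deriv (smoothStep ε a) x * h x) volume 0 1 :=
      fun a => (continuous_deriv_smoothStep.mul hh).intervalIntegrable _ _
    rw [intervalIntegral.integral_sub (hi s) (hi t)] at b3
    have hχi : ∫ x in (0 : ℝ)..1, |χ x| ≤ t + ε - s := by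
      have hle : ∀ x, |χ x| ≤ (Set.Icc s (t + ε)).indicator (fun _ => (1 : ℝ)) x := by
        intro x
        have n0 : ∀ a, 0 ≤ smoothStep ε a x := fun a => Real.smoothTransition.nonneg _
        have n1 : ∀ a, smoothStep ε a x ≤ 1 := fun a => Real.smoothTransition.le_one _
        by_cases hx : x ∈ Set.Icc s (t + ε)
        · rw [Set.indicator_of_mem hx, abs_le]
          constructor <;> simp only [χ] <;> linarith [n0 s, n0 t, n1 s, n1 t]
        · rw [Set.indicator_of_notMem hx]
          rw [Set.mem_Icc, not_and_or, not_le, not_le] at hx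
          rcases hx with hx | hx
          · simp [χ, smoothStep_of_le hε hx.le, smoothStep_of_le hε (hx.le.trans hst.le)]
          · simp [χ, smoothStep_of_ge hε hx.le,
              smoothStep_of_ge hε (by linarith : s + ε ≤ x)]
      have hI : Integrable ((Set.Icc s (t + ε)).indicator (fun _ => (1 : ℝ))) volume :=
        (integrable_indicator_iff measurableSet_Icc).2 (by simp)
      calc ∫ x in (0 : ℝ)..1, |χ x|
          ≤ ∫ x in (0 : ℝ)..1, (Set.Icc s (t + ε)).indicator (fun _ => (1 : ℝ)) x :=
            intervalIntegral.integral_mono_on zero_le_one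
              (hχ.continuous.abs.intervalIntegrable _ _) hI.intervalIntegrable fun x _ => hle x
        _ ≤ ∫ x, (Set.Icc s (t + ε)).indicator (fun _ => (1 : ℝ)) x := by
            rw [intervalIntegral.integral_of_le zero_le_one]
            exact setIntegral_le_integral hI
              (Eventually.of_forall fun x => Set.indicator_nonneg (fun _ _ => zero_le_one) x)
        _ = t + ε - s := by
            rw [integral_indicator measurableSet_Icc]
            simp
            linarith
    have b4 : M * ε ≤ η / 4 := by
      have : (M + 1) * ε ≤ η / 4 := by
        calc (M + 1) * ε ≤ (M + 1) * (η / (4 * (M + 1))) := by gcongr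
          _ = η / 4 := by field_simp
      linarith
    have b5 := b3.trans (mul_le_mul_of_nonneg_left hχi hM)
    rw [abs_le] at b1 b2 b5 ⊢
    constructor <;> linarith [b1.1, b1.2, b2.1, b2.2, b5.1, b5.2]
  rcases hst.eq_or_lt with rfl | hst
  · simp
  -- The step at t needs room to its right, so t = 1 is reached by closure.
  have hcl : IsClosed {r | |h r - h s| ≤ M * (r - s)} :=
    isClosed_le (by fun_prop) (by fun_prop)
  have hsub : Set.Ioo s 1 ⊆ {r | |h r - h s| ≤ M * (r - s)} := fun r hr => key r hr.1 hr.2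
  have := closure_minimal hsub hcl
  rw [closure_Ioo (by linarith)] at this
  exact this ⟨hst.le, ht⟩

lemma integral_unitInterval (f : ℝ → ℝ) : ∫ t : I, f t = ∫ x in (0 : ℝ)..1, f x := by
  rw [intervalIntegral.integral_of_le zero_le_one, ← integral_Icc_eq_integral_Ioc]
  exact integral_subtype_comap measurableSet_Icc f

end WeakDerivative

/-! ### Time regularity from the continuity equation. -/

section ContinuityEquation

variable {d : ℕ} {Ω : Set (EuclideanSpace ℝ (Fin d))}

lemma continuous_integral_probability [CompactSpace Ω] (ρ : C(I, ProbabilityMeasure Ω))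
    (f : C(Ω, ℝ)) : Continuous fun t => ∫ x, f x ∂(ρ t : Measure Ω) := by
  have := (ProbabilityMeasure.continuous_integral_boundedContinuousFunction
    (BoundedContinuousFunction.mkOfCompact f))
  exact this.comp ρ.continuous

/-- Along a solution of the continuity equation with bounded flux, integrals of Lipschitz functions
are Lipschitz in time. -/
theorem dist_integral_le_of_admissible [CompactSpace Ω] {ρ : C(I, ProbabilityMeasure Ω)}
    {q : I → VectorMeasure Ω (EuclideanSpace ℝ (Fin d))} (h : Admissible ρ q) {C : ℝ≥0}
    (hC : ∀ᵐ t : I, (q t).variation Set.univ ≤ C) {ζ : EuclideanSpace ℝ (Fin d) → ℝ}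
    (hζ : ContDiff ℝ ∞ ζ) {K : ℝ≥0} (hK : LipschitzWith K ζ) (s t : I) :
    dist (∫ x : Ω, ζ x ∂(ρ s : Measure Ω)) (∫ x : Ω, ζ x ∂(ρ t : Measure Ω))
      ≤ (C * K : ℝ≥0) * dist s t := by
  let ζc : C(Ω, ℝ) := ⟨fun x => ζ x, hζ.continuous.comp continuous_subtype_val⟩
  have hgc : Continuous fun x => gradient ζ x := by
    unfold gradient
    exact (LinearIsometryEquiv.continuous _).comp (hζ.continuous_fderiv (by simp))
  let γ : C(Ω, EuclideanSpace ℝ (Fin d)) :=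
    ⟨fun x => gradient ζ (x : EuclideanSpace ℝ (Fin d)), hgc.comp continuous_subtype_val⟩
  have hγ : ‖γ‖ ≤ K := by
    refine (ContinuousMap.norm_le _ K.2).2 fun x => ?_
    change ‖gradient ζ x‖ ≤ K
    rw [gradient, LinearIsometryEquiv.norm_map]
    exact norm_fderiv_le_of_lipschitz ℝ hK
  let h₀ : C(I, ℝ) := ⟨fun t => ∫ x : Ω, ζ x ∂(ρ t : Measure Ω),
    continuous_integral_probability ρ ζc⟩
  let g : I → ℝ := fun t => pairing γ (q t)
  have hgb : ∀ᵐ t : I, ‖g t‖ ≤ C * K := by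
    filter_upwards [hC] with t ht
    refine (norm_pairing_le γ (q t)).trans ?_
    gcongr
    exact ENNReal.toReal_le_coe_of_le_coe ht
  have hgi : Integrable g := Integrable.of_bound (h.isL1Curve.measurable γ) _ hgb
  let H : ℝ → ℝ := Set.IccExtend zero_le_one h₀
  have hH : Continuous H := h₀.continuous.Icc_extend'
  have hHI : ∀ t : I, H t = h₀ t := fun t => Set.IccExtend_val _ _ t
  have hweak : ∀ χ : ℝ → ℝ, ContDiff ℝ ∞ χ → χ 0 = 0 → χ 1 = 0 →
      |∫ x in (0 : ℝ)..1, deriv χ x * H x| ≤ (C * K : ℝ≥0) * ∫ x in (0 : ℝ)..1, |χ x| := by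
    intro χ hχ h0 h1
    -- Testing with a product shows that the weak time derivative of ∫ ζ dρ_t is the pairing of ∇ζ
    -- with q_t, bounded by C K.
    have ce := h.continuityEquation (fun p => χ p.1 * ζ p.2)
      ((hχ.comp contDiff_fst).mul (hζ.comp contDiff_snd)) (fun x _ => by simp [h0, h1])
    have e1 : ∀ t : I, ∫ x : Ω, deriv (fun s : ℝ => χ s * ζ x) t ∂(ρ t : Measure Ω)
        = deriv χ t * H t := by
      intro t
      rw [hHI]
      have : ∀ x : Ω, deriv (fun s : ℝ => χ s * ζ x) t = deriv χ t * ζ x := fun x =>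
        deriv_mul_const (hχ.differentiable (by simp) _) _
      simp_rw [this]
      exact integral_const_mul _ _
    have e2 : ∀ t : I, pairing (fun x : Ω => gradient (fun y => χ t * ζ y)
        (x : EuclideanSpace ℝ (Fin d))) (q t) = χ t * g t := by
      intro t
      have : ∀ x : Ω, gradient (fun y => χ t * ζ y) (x : EuclideanSpace ℝ (Fin d))
          = χ t • γ x := by
        intro x
        simp only [gradient, γ, ContinuousMap.coe_mk]
        rw [fderiv_const_mul (hζ.differentiable (by simp) _), map_smul]
      simp_rw [this]
      exact VectorMeasure.integral_fun_smul (q t) _ (χ t) γ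
    simp only [e1, e2] at ce
    have i1 : Integrable fun t : I => deriv χ t * H t := by
      refine Continuous.integrable_of_hasCompactSupport ?_ (HasCompactSupport.of_compactSpace _)
      exact ((hχ.continuous_deriv (by simp)).mul hH).comp continuous_subtype_val
    have i2 : Integrable fun t : I => χ t * g t := by
      obtain ⟨b, hb⟩ := (isCompact_univ (X := I)).exists_bound_of_continuousOn
        (f := fun t : I => χ t) (hχ.continuous.comp continuous_subtype_val).continuousOn
      exact hgi.bdd_mul (c := b) (hχ.continuous.comp
        continuous_subtype_val).stronglyMeasurable.aestronglyMeasurable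
        (Eventually.of_forall fun t => hb t trivial)
    rw [integral_add i1 i2] at ce
    rw [← integral_unitInterval (fun x => deriv χ x * H x), eq_neg_of_add_eq_zero_left ce, abs_neg,
      ← integral_unitInterval (fun x => |χ x|), ← Real.norm_eq_abs, ← integral_const_mul]
    refine norm_integral_le_of_norm_le ?_ ?_
    · refine Continuous.integrable_of_hasCompactSupport ?_ (HasCompactSupport.of_compactSpace _)
      exact continuous_const.mul (hχ.continuous.abs.comp continuous_subtype_val)
    · filter_upwards [hgb] with t ht
      rw [norm_mul, mul_comm, NNReal.coe_mul]
      exact mul_le_mul_of_nonneg_right ht (norm_nonneg _)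
  have hmain : ∀ s t : I, s ≤ t → dist (h₀ s) (h₀ t) ≤ (C * K : ℝ≥0) * dist s t := by
    intro s t hst
    have := abs_sub_le_of_weak_derivative_bound hH (NNReal.coe_nonneg _) hweak s.2.1
      (show (s : ℝ) ≤ t from hst) t.2.2
    rw [hHI, hHI] at this
    rw [dist_comm, Real.dist_eq, dist_comm s t, Subtype.dist_eq, Real.dist_eq,
      abs_of_nonneg (sub_nonneg.2 (show (s : ℝ) ≤ t from hst))]
    exact this
  rcases le_total s t with hst | hst
  · exact hmain s t hst
  · rw [dist_comm, dist_comm s]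
    exact hmain t s hst

end ContinuityEquation

/-! ### From weak to pointwise convergence in time. -/

section WeakConvergence

/-- Equi-Lipschitz functions of time that converge weakly converge pointwise. -/
theorem tendsto_of_lipschitz_of_tendsto_integral {h : ℕ → I → ℝ} {h₀ : I → ℝ} {M : ℝ≥0}
    (hL : ∀ n, LipschitzWith M (h n)) (hc : Continuous h₀)
    (hw : ∀ χ : C(I, ℝ), Tendsto (fun n => ∫ t, χ t * h n t) atTop (𝓝 (∫ t, χ t * h₀ t))) (t₀ : I) :
    Tendsto (fun n => h n t₀) atTop (𝓝 (h₀ t₀)) := by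
  rw [Metric.tendsto_atTop]
  intro ε hε
  obtain ⟨δ₁, hδ₁, H₁⟩ := Metric.continuous_iff.1 hc t₀ (ε / 4) (by positivity)
  obtain ⟨δ, hδ, hδ'⟩ : ∃ δ > 0, δ < min δ₁ (ε / (4 * (M + 1))) :=
    exists_between (lt_min hδ₁ (by positivity))
  rw [lt_min_iff] at hδ'
  -- A tent around t₀, so narrow that on its support each of h n and h₀ varies by at most ε / 4; its
  -- positive mass c is divided out at the end.
  let χ₀ : ℝ → ℝ := fun x => max 0 (δ - |x - t₀|)
  have hχ₀ : Continuous χ₀ := by fun_prop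
  have hχn : ∀ x, 0 ≤ χ₀ x := fun x => le_max_left _ _
  let χ : C(I, ℝ) := ⟨fun t => χ₀ t, hχ₀.comp continuous_subtype_val⟩
  have hinteg : ∀ f : I → ℝ, Continuous f → Integrable f := fun f hf =>
    hf.integrable_of_hasCompactSupport (HasCompactSupport.of_compactSpace _)
  set c : ℝ := ∫ t, χ t with hcdef
  have hcpos : 0 < c := by
    rw [hcdef]
    change 0 < ∫ t : I, χ₀ t
    rw [integral_unitInterval]
    refine intervalIntegral.integral_pos zero_lt_one hχ₀.continuousOn (fun x _ => hχn x)
      ⟨t₀, t₀.2, ?_⟩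
    simp [χ₀, hδ]
  have near : ∀ n t, χ t * |h n t - h₀ t - (h n t₀ - h₀ t₀)| ≤ χ t * (ε / 2) := by
    intro n t
    by_cases ht : dist t t₀ < δ
    · refine mul_le_mul_of_nonneg_left ?_ (hχn t)
      have a1 := (hL n).dist_le_mul t t₀
      have a2 := H₁ t (ht.trans hδ'.1)
      have a3 : (M : ℝ) * dist t t₀ ≤ ε / 4 := by
        calc (M : ℝ) * dist t t₀ ≤ (M + 1) * (ε / (4 * (M + 1))) := by
              gcongr
              · linarith
              · exact (ht.trans hδ'.2).le
          _ = ε / 4 := by field_simp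
      rw [Real.dist_eq] at a1 a2
      have a4 := abs_sub (h n t - h n t₀) (h₀ t - h₀ t₀)
      have a5 : h n t - h₀ t - (h n t₀ - h₀ t₀) = h n t - h n t₀ - (h₀ t - h₀ t₀) := by ring
      rw [a5]
      linarith
    · have : χ t = 0 := by
        refine max_eq_left ?_
        have : δ ≤ |(t : ℝ) - t₀| := by
          have := not_lt.1 ht
          rwa [Subtype.dist_eq, Real.dist_eq] at this
        linarith
      rw [this, zero_mul, zero_mul]
  obtain ⟨N, hN⟩ := Metric.tendsto_atTop.1 (hw χ) (c * (ε / 2)) (by positivity)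
  refine ⟨N, fun n hn => ?_⟩
  have hcn := (hL n).continuous
  have e1 : c * (h n t₀ - h₀ t₀) = ((∫ t, χ t * h n t) - ∫ t, χ t * h₀ t)
      - ∫ t, χ t * (h n t - h₀ t - (h n t₀ - h₀ t₀)) := by
    have i1 := hinteg _ (χ.continuous.mul hcn)
    have i2 := hinteg _ (χ.continuous.mul hc)
    have i3 : Integrable fun t => χ t * (h n t₀ - h₀ t₀) :=
      hinteg _ (χ.continuous.mul continuous_const)
    have : ∀ t, χ t * (h n t - h₀ t - (h n t₀ - h₀ t₀))
        = χ t * h n t - χ t * h₀ t - χ t * (h n t₀ - h₀ t₀) := fun t => by ring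
    simp_rw [this]
    have e := integral_sub (i1.sub i2) i3
    simp only [Pi.sub_apply, Pi.mul_apply] at e
    have e' := integral_sub i1 i2
    simp only [Pi.mul_apply] at e'
    rw [e, e', integral_mul_const]
    ring
  have e2 : |∫ t, χ t * (h n t - h₀ t - (h n t₀ - h₀ t₀))| ≤ c * (ε / 2) := by
    rw [hcdef, ← integral_mul_const, ← Real.norm_eq_abs]
    refine norm_integral_le_of_norm_le (hinteg _ (χ.continuous.mul continuous_const))
      (Eventually.of_forall fun t => ?_)
    rw [norm_mul, Real.norm_of_nonneg (show 0 ≤ χ t from hχn t)]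
    exact near n t
  have e3 := hN n hn
  rw [Real.dist_eq] at e3 ⊢
  have e4 : c * |h n t₀ - h₀ t₀| < c * ε := by
    rw [← abs_of_pos hcpos, ← abs_mul, abs_of_pos hcpos, e1]
    refine (abs_sub _ _).trans_lt ?_
    linarith
  exact lt_of_mul_lt_mul_left e4 hcpos.le

end WeakConvergence

/-! ### The Gaussian kernel. -/

section Kernel

variable {V : Type*} [NormedAddCommGroup V]

/-- A smooth kernel that decreases to the indicator of the origin. -/
def kernel (j : ℕ) (z : V) : ℝ := Real.exp (-(j * ‖z‖ ^ 2))

lemma kernel_nonneg (j : ℕ) (z : V) : 0 ≤ kernel j z := (Real.exp_pos _).le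

lemma kernel_le_one (j : ℕ) (z : V) : kernel j z ≤ 1 :=
  Real.exp_le_one_iff.2 (neg_nonpos.2 (by positivity))

lemma kernel_zero (j : ℕ) : kernel j (0 : V) = 1 := by simp [kernel]

lemma contDiff_kernel [InnerProductSpace ℝ V] (j : ℕ) : ContDiff ℝ ∞ (kernel j : V → ℝ) :=
  Real.contDiff_exp.comp (contDiff_const.mul (contDiff_norm_sq ℝ)).neg

lemma lipschitzWith_kernel (j : ℕ) : LipschitzWith (1 + j) (kernel j : V → ℝ) := by
  have hd : ∀ r : ℝ, HasDerivAt (fun r : ℝ => Real.exp (-(j * r ^ 2)))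
      (Real.exp (-(j * r ^ 2)) * -(j * (2 * r))) r := by
    intro r
    have := ((hasDerivAt_pow 2 r).const_mul (j : ℝ)).neg.exp
    simpa using this
  have hs : LipschitzWith (1 + j) fun r : ℝ => Real.exp (-(j * r ^ 2)) := by
    refine lipschitzWith_of_nnnorm_deriv_le (fun r => (hd r).differentiableAt) fun r => ?_
    rw [(hd r).deriv, ← NNReal.coe_le_coe, coe_nnnorm, norm_mul,
      Real.norm_of_nonneg (Real.exp_pos _).le, Real.exp_neg, inv_mul_le_iff₀ (Real.exp_pos _), norm_neg, norm_mul, norm_mul]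
    simp only [Real.norm_ofNat, Real.norm_eq_abs, Nat.abs_cast, NNReal.coe_add, NNReal.coe_one,
      NNReal.coe_natCast]
    -- The derivative bound follows from 1 + x ≤ exp x together with 2|r| ≤ 1 + r².
    have h1 := Real.add_one_le_exp ((j : ℝ) * r ^ 2)
    have hj : (0 : ℝ) ≤ j := Nat.cast_nonneg j
    have h2 : (j : ℝ) * (2 * |r|) ≤ j * (1 + r ^ 2) := by
      gcongr
      nlinarith [sq_nonneg (1 - |r|), sq_abs r]
    have h3 : (j : ℝ) * (1 + r ^ 2) ≤ (j * r ^ 2 + 1) * (1 + j) := by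
      nlinarith [mul_nonneg (mul_nonneg hj hj) (sq_nonneg r)]
    have h4 : (j * r ^ 2 + 1) * (1 + (j : ℝ)) ≤ Real.exp (j * r ^ 2) * (1 + j) := by gcongr
    linarith
  have := hs.comp (lipschitzWith_one_norm (E := V))
  rwa [mul_one] at this

lemma tendsto_kernel {z : V} (hz : z ≠ 0) : Tendsto (fun j => kernel j z) atTop (𝓝 0) := by
  refine Real.tendsto_exp_atBot.comp (tendsto_neg_atTop_atBot.comp ?_)
  exact tendsto_natCast_atTop_atTop.atTop_mul_const (by positivity)

end Kernel

/-! ### Smoothed atomic masses and their uniform convergence. -/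

section SmoothedMass

variable {d : ℕ} {Ω : Set (EuclideanSpace ℝ (Fin d))}

/-- The mass of `ρ` near `x`, at a scale that shrinks as `j` grows. -/
def smoothedMass (j : ℕ) (ρ : ProbabilityMeasure Ω) (x : Ω) : ℝ :=
  ∫ y : Ω, kernel j ((y : EuclideanSpace ℝ (Fin d)) - x) ∂(ρ : Measure Ω)

lemma continuous_kernel_sub (j : ℕ) (x : Ω) :
    Continuous fun y : Ω => kernel j ((y : EuclideanSpace ℝ (Fin d)) - x) :=
  (contDiff_kernel j).continuous.comp (continuous_subtype_val.sub continuous_const)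

lemma integrable_kernel_sub (j : ℕ) (ρ : ProbabilityMeasure Ω) (x : Ω) :
    Integrable (fun y : Ω => kernel j ((y : EuclideanSpace ℝ (Fin d)) - x)) (ρ : Measure Ω) :=
  Integrable.of_bound (continuous_kernel_sub j x).stronglyMeasurable.aestronglyMeasurable 1
    (Eventually.of_forall fun y => by
      rw [Real.norm_of_nonneg (kernel_nonneg _ _)]; exact kernel_le_one _ _)

lemma smoothedMass_nonneg (j : ℕ) (ρ : ProbabilityMeasure Ω) (x : Ω) : 0 ≤ smoothedMass j ρ x :=
  integral_nonneg fun _ => kernel_nonneg _ _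

lemma lipschitzWith_smoothedMass (j : ℕ) (ρ : ProbabilityMeasure Ω) :
    LipschitzWith (1 + j) (smoothedMass j ρ) := by
  refine LipschitzWith.of_dist_le_mul fun x x' => ?_
  rw [smoothedMass, smoothedMass, dist_eq_norm,
    ← integral_sub (integrable_kernel_sub j ρ x) (integrable_kernel_sub j ρ x')]
  refine (norm_integral_le_of_norm_le_const (C := ((1 + j : ℝ≥0) : ℝ) * dist x x')
    (Eventually.of_forall fun y => ?_)).trans_eq (by simp)
  rw [← dist_eq_norm]
  refine ((lipschitzWith_kernel j).dist_le_mul _ _).trans_eq ?_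
  rw [dist_sub_left, Subtype.dist_eq]

/-- The kernel is nonnegative and equals 1 at the origin. Smoothing from above is essential: the
negative power turns it into a weight from below. -/
lemma measure_singleton_le_smoothedMass (j : ℕ) (ρ : ProbabilityMeasure Ω) (x : Ω) :
    (ρ : Measure Ω) {x} ≤ ENNReal.ofReal (smoothedMass j ρ x) := by
  rw [smoothedMass, ofReal_integral_eq_lintegral_ofReal (integrable_kernel_sub j ρ x)
    (Eventually.of_forall fun _ => kernel_nonneg _ _)]
  refine le_trans ?_ (setLIntegral_le_lintegral {x} _)
  rw [lintegral_singleton, sub_self, kernel_zero]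
  simp

lemma tendsto_smoothedMass (ρ : ProbabilityMeasure Ω) (x : Ω) :
    Tendsto (fun j => smoothedMass j ρ x) atTop (𝓝 ((ρ : Measure Ω).real {x})) := by
  have h : Tendsto (fun j => smoothedMass j ρ x) atTop
      (𝓝 (∫ y, ({x} : Set Ω).indicator (fun _ => (1 : ℝ)) y ∂(ρ : Measure Ω))) := by
    refine tendsto_integral_of_dominated_convergence (fun _ => 1)
      (fun j => (integrable_kernel_sub j ρ x).aestronglyMeasurable) (integrable_const _)
      (fun j => Eventually.of_forall fun y => ?_) (Eventually.of_forall fun y => ?_)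
    · rw [Real.norm_of_nonneg (kernel_nonneg _ _)]; exact kernel_le_one _ _
    · by_cases hy : y = x
      · subst hy
        simp [kernel_zero]
      · rw [Set.indicator_of_notMem (by simpa using hy)]
        exact tendsto_kernel (sub_ne_zero.2 fun h => hy (Subtype.ext h))
  rwa [integral_indicator_const _ (measurableSet_singleton x), smul_eq_mul, mul_one] at h

variable [CompactSpace Ω] {ρn : ℕ → C(I, ProbabilityMeasure Ω)}
  {qn : ℕ → I → VectorMeasure Ω (EuclideanSpace ℝ (Fin d))} {ρ : C(I, ProbabilityMeasure Ω)}

/-- The kernel centred at x is a smooth Lipschitz test function. The constant depends only on C and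
j, hence is uniform along the sequence. -/
lemma lipschitzWith_smoothedMass_time {q : I → VectorMeasure Ω (EuclideanSpace ℝ (Fin d))}
    (h : Admissible ρ q) {C : ℝ≥0} (hC : ∀ᵐ t : I, (q t).variation Set.univ ≤ C) (j : ℕ) (x : Ω) :
    LipschitzWith (C * (1 + j)) fun t => smoothedMass j (ρ t) x := by
  have hK : LipschitzWith (1 + j)
      fun y : EuclideanSpace ℝ (Fin d) => kernel j (y - (x : EuclideanSpace ℝ (Fin d))) := by
    refine LipschitzWith.of_dist_le_mul fun y z => ?_
    refine ((lipschitzWith_kernel j).dist_le_mul _ _).trans_eq ?_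
    rw [dist_sub_right]
  exact LipschitzWith.of_dist_le_mul fun s t => dist_integral_le_of_admissible h hC
    ((contDiff_kernel j).comp (contDiff_id.sub contDiff_const)) hK s t

lemma lipschitzWith_smoothedMass_prod {q : I → VectorMeasure Ω (EuclideanSpace ℝ (Fin d))}
    (h : Admissible ρ q) {C : ℝ≥0} (hC : ∀ᵐ t : I, (q t).variation Set.univ ≤ C) (j : ℕ) :
    LipschitzWith (C * (1 + j) + (1 + j)) fun p : I × Ω => smoothedMass j (ρ p.1) p.2 :=
  LipschitzWith.uncurry (fun x => lipschitzWith_smoothedMass_time h hC j x)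
    fun t => lipschitzWith_smoothedMass j (ρ t)

lemma tendsto_smoothedMass_curve (hadm : ∀ n, Admissible (ρn n) (qn n)) {C : ℝ≥0}
    (hC : ∀ n, ∀ᵐ t : I, (qn n t).variation Set.univ ≤ C)
    (hρ : ∀ φ : C(I × Ω, ℝ),
      Tendsto (fun n => ∫ t : I, ∫ x : Ω, φ (t, x) ∂(ρn n t : Measure Ω)) atTop
      (𝓝 (∫ t : I, ∫ x : Ω, φ (t, x) ∂(ρ t : Measure Ω)))) (j : ℕ) (t : I) (x : Ω) :
    Tendsto (fun n => smoothedMass j (ρn n t) x) atTop (𝓝 (smoothedMass j (ρ t) x)) := by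
  refine tendsto_of_lipschitz_of_tendsto_integral (h := fun n t => smoothedMass j (ρn n t) x)
    (h₀ := fun t => smoothedMass j (ρ t) x)
    (fun n => lipschitzWith_smoothedMass_time (hadm n) (hC n) j x)
    (continuous_integral_probability ρ ⟨_, continuous_kernel_sub j x⟩) (fun χ => ?_) t
  have := hρ ⟨fun p => χ p.1 * kernel j ((p.2 : EuclideanSpace ℝ (Fin d)) - x),
    (χ.continuous.comp continuous_fst).mul ((continuous_kernel_sub j x).comp continuous_snd)⟩
  simp only [ContinuousMap.coe_mk, integral_const_mul] at this
  exact this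

/-- The smoothed masses converge uniformly in time and space. -/
theorem tendstoUniformly_smoothedMass (hadm : ∀ n, Admissible (ρn n) (qn n)) {C : ℝ≥0}
    (hC : ∀ n, ∀ᵐ t : I, (qn n t).variation Set.univ ≤ C)
    (hρ : ∀ φ : C(I × Ω, ℝ),
      Tendsto (fun n => ∫ t : I, ∫ x : Ω, φ (t, x) ∂(ρn n t : Measure Ω)) atTop
      (𝓝 (∫ t : I, ∫ x : Ω, φ (t, x) ∂(ρ t : Measure Ω)))) (j : ℕ) :
    TendstoUniformly (fun n (p : I × Ω) => smoothedMass j (ρn n p.1) p.2)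
      (fun p => smoothedMass j (ρ p.1) p.2) atTop := by
  -- On the compact space I × Ω, equicontinuity upgrades pointwise to uniform convergence.
  have heq : Equicontinuous fun n (p : I × Ω) => smoothedMass j (ρn n p.1) p.2 :=
    (LipschitzWith.uniformEquicontinuous _ _
      fun n => lipschitzWith_smoothedMass_prod (hadm n) (hC n) j).equicontinuous
  have := (heq.tendsto_uniformFun_iff_pi atTop (fun p => smoothedMass j (ρ p.1) p.2)).2
    (tendsto_pi_nhds.2 fun p => tendsto_smoothedMass_curve hadm hC hρ j p.1 p.2)
  exact UniformFun.tendsto_iff_tendstoUniformly.1 this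

end SmoothedMass

/-! ### Continuous weights and lower semicontinuity. -/

section LowerSemicontinuity

variable {d : ℕ} {Ω : Set (EuclideanSpace ℝ (Fin d))} {α : ℝ}

/-- A continuous weight that approximates `ρ {x} ^ (α - 1)` as `j` grows. -/
def weight (α : ℝ) (j : ℕ) (ρ : ProbabilityMeasure Ω) (x : Ω) : ℝ :=
  (1 / ((j : ℝ) + 1) + smoothedMass j ρ x) ^ (α - 1)

lemma smoothedMass_add_pos (j : ℕ) (ρ : ProbabilityMeasure Ω) (x : Ω) :
    0 < 1 / ((j : ℝ) + 1) + smoothedMass j ρ x :=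
  add_pos_of_pos_of_nonneg (by positivity) (smoothedMass_nonneg _ _ _)

lemma weight_nonneg (α : ℝ) (j : ℕ) (ρ : ProbabilityMeasure Ω) (x : Ω) : 0 ≤ weight α j ρ x :=
  Real.rpow_nonneg (smoothedMass_add_pos _ _ _).le _

lemma ofReal_weight (α : ℝ) (j : ℕ) (ρ : ProbabilityMeasure Ω) (x : Ω) :
    ENNReal.ofReal (weight α j ρ x)
      = ENNReal.ofReal (1 / ((j : ℝ) + 1) + smoothedMass j ρ x) ^ (α - 1) :=
  (ENNReal.ofReal_rpow_of_pos (smoothedMass_add_pos _ _ _)).symm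

lemma tendsto_ofReal_weight (α : ℝ) (ρ : ProbabilityMeasure Ω) (x : Ω) :
    Tendsto (fun j => ENNReal.ofReal (weight α j ρ x)) atTop
      (𝓝 ((ρ : Measure Ω) {x} ^ (α - 1))) := by
  simp_rw [ofReal_weight]
  have h := (tendsto_one_div_add_atTop_nhds_zero_nat (𝕜 := ℝ)).add (tendsto_smoothedMass ρ x)
  rw [zero_add] at h
  have h' := ENNReal.tendsto_ofReal h
  rw [ofReal_measureReal] at h'
  exact (ENNReal.continuous_rpow_const.tendsto _).comp h'

/-- Under the hypothesis ρ'({x}) is at most the base of the weight of ρ, and the negative exponent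
reverses the inequality. It is applied with ρ' = ρⁿ_t and ρ = ρ_t. -/
lemma lintegral_weight_le_F (hα_pos : 0 < α) (hα_lt_one : α < 1) {j : ℕ}
    {ρ ρ' : ProbabilityMeasure Ω}
    (h : ∀ x, smoothedMass j ρ' x ≤ 1 / ((j : ℝ) + 1) + smoothedMass j ρ x)
    (q : VectorMeasure Ω (EuclideanSpace ℝ (Fin d))) :
    ∫⁻ x, ENNReal.ofReal (weight α j ρ x) ∂q.variation ≤ F α ρ' q := by
  refine (lintegral_mono fun x => ?_).trans (atomicCost_le_F hα_pos ρ' q)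
  rw [ofReal_weight]
  exact ennreal_rpow_le_rpow_of_nonpos (by linarith)
    ((measure_singleton_le_smoothedMass j ρ' x).trans (ENNReal.ofReal_le_ofReal (h x)))

lemma F_le_liminf_lintegral_weight (hα_pos : 0 < α) (hα_lt_one : α < 1)
    (ρ : ProbabilityMeasure Ω) (hw : ∀ j, Continuous (weight α j ρ))
    (q : VectorMeasure Ω (EuclideanSpace ℝ (Fin d))) :
    F α ρ q ≤ liminf (fun j => ∫⁻ x, ENNReal.ofReal (weight α j ρ x) ∂q.variation) atTop := by
  refine (F_le_atomicCost hα_pos hα_lt_one ρ q).trans ?_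
  rw [atomicCost]
  simp_rw [← (tendsto_ofReal_weight α ρ _).liminf_eq]
  exact lintegral_liminf_le fun j => (hw j).measurable.ennreal_ofReal

variable [CompactSpace Ω]

/-- Lower semicontinuity of the weighted mass of the flux under weak convergence in space-time. -/
theorem lintegral_weighted_variation_le {w : C(I × Ω, ℝ)} (hw : ∀ p, 0 ≤ w p)
    {qn : ℕ → I → VectorMeasure Ω (EuclideanSpace ℝ (Fin d))}
    {q : I → VectorMeasure Ω (EuclideanSpace ℝ (Fin d))} (hq : IsL1Curve q)
    (hflux : ∀ Φ : C(I × Ω, EuclideanSpace ℝ (Fin d)),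
      Tendsto (fun n => ∫ t : I, pairing (fun x : Ω => Φ (t, x)) (qn n t)) atTop
        (𝓝 (∫ t : I, pairing (fun x : Ω => Φ (t, x)) (q t))))
    {c : ℕ → ℝ≥0∞} (hc : ∀ᶠ n in atTop,
      ∫⁻ t : I, ∫⁻ x, ENNReal.ofReal (w (t, x)) ∂(qn n t).variation ≤ c n) :
    AEMeasurable (fun t : I => ∫⁻ x, ENNReal.ofReal (w (t, x)) ∂(q t).variation) ∧
      ∫⁻ t : I, ∫⁻ x, ENNReal.ofReal (w (t, x)) ∂(q t).variation ≤ liminf c atTop := by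
  have hnorm : ∀ t : I, ∫⁻ x, ENNReal.ofReal (w (t, x)) ∂(q t).variation
      = ‖weightedPairing (w.curry t) (q t)‖ₑ := fun t =>
    lintegral_variation_eq_enorm (w := w.curry t) (fun x => hw (t, x)) (q t)
  have hmeas : ∀ f, AEStronglyMeasurable (fun t : I => weightedPairing (w.curry t) (q t) f) := by
    intro f
    let Φ : C(I × Ω, EuclideanSpace ℝ (Fin d)) :=
      ⟨fun p => w p • f p.2, w.continuous.smul (f.continuous.comp continuous_snd)⟩
    exact aestronglyMeasurable_clm_apply (A := fun t => pairingCLM (q t)) (Ψ := fun t => Φ.curry t)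
      hq.measurable Φ.curry.continuous.stronglyMeasurable.aestronglyMeasurable
  have hfin : ∫⁻ t : I, ‖weightedPairing (w.curry t) (q t)‖ₑ ≠ ⊤ := by
    simp_rw [← hnorm]
    refine ne_of_lt (lt_of_le_of_lt (b := ∫⁻ t : I,
      ENNReal.ofReal ‖w‖ * (q t).variation Set.univ) (lintegral_mono fun t => ?_) ?_)
    · rw [← lintegral_const]
      exact lintegral_mono fun x =>
        ENNReal.ofReal_le_ofReal ((le_abs_self _).trans (w.norm_coe_le_norm (t, x)))
    · rw [lintegral_const_mul' _ _ ENNReal.ofReal_ne_top]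
      exact ENNReal.mul_lt_top ENNReal.ofReal_lt_top hq.integrable
  simp_rw [hnorm]
  refine ⟨aemeasurable_enorm_clm hmeas, lintegral_enorm_clm_le hmeas hfin fun Ψ hΨ => ?_⟩
  -- Absorbing w into the test field leaves a single continuous field, to which the weak convergence
  -- of the fluxes applies.
  let Φ : C(I × Ω, EuclideanSpace ℝ (Fin d)) :=
    ⟨fun p => w p • Ψ p.1 p.2, w.continuous.smul (ContinuousMap.continuous_uncurry_of_continuous Ψ)⟩
  have hlim := (ENNReal.tendsto_ofReal (hflux Φ)).liminf_eq
  change ENNReal.ofReal (∫ t : I, pairing (fun x : Ω => Φ (t, x)) (q t)) ≤ _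
  rw [← hlim]
  refine liminf_le_liminf (hc.mono fun n hn => ?_)
  calc ENNReal.ofReal (∫ t : I, pairing (fun x : Ω => Φ (t, x)) (qn n t))
      ≤ ‖∫ t : I, pairing (fun x : Ω => Φ (t, x)) (qn n t)‖ₑ := by
        rw [← ofReal_norm]
        exact ENNReal.ofReal_le_ofReal (le_abs_self _)
    _ ≤ ∫⁻ t : I, ‖pairing (fun x : Ω => Φ (t, x)) (qn n t)‖ₑ :=
        enorm_integral_le_lintegral_enorm _
    _ ≤ ∫⁻ t : I, ∫⁻ x, ENNReal.ofReal (w (t, x)) ∂(qn n t).variation := by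
        refine lintegral_mono fun t => (enorm_pairing_le _ _).trans (lintegral_mono fun x => ?_)
        rw [← ofReal_norm]
        refine ENNReal.ofReal_le_ofReal ?_
        change ‖w (t, x) • Ψ t x‖ ≤ w (t, x)
        rw [norm_smul, Real.norm_of_nonneg (hw _)]
        exact mul_le_of_le_one_right (hw _) (((Ψ t).norm_coe_le_norm x).trans (hΨ t))
    _ ≤ c n := hn

end LowerSemicontinuity

end

end BranchedTransport

/-! ### Assembly of the proof. -/

theorem mainTheorem2 {d : ℕ} {Ω : Set (EuclideanSpace ℝ (Fin d))}
    (hΩ_compact : IsCompact Ω) (hΩ_convex : Convex ℝ Ω)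
    {α : ℝ} (hα_pos : 0 < α) (hα_lt_one : α < 1)
    (ρn : ℕ → C(I, ProbabilityMeasure Ω))
    (qn : ℕ → I → VectorMeasure Ω (EuclideanSpace ℝ (Fin d)))
    (hn : ∀ n, BranchedTransport.Admissible (ρn n) (qn n))
    (ρ : C(I, ProbabilityMeasure Ω))
    (q : I → VectorMeasure Ω (EuclideanSpace ℝ (Fin d)))
    (hq : BranchedTransport.IsL1Curve q)
    (hτ : BranchedTransport.TauConverges α ρn qn ρ q) :
    BranchedTransport.cost α ρ q ≤ liminf (fun n => BranchedTransport.cost α (ρn n) (qn n)) atTop ∧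
      ∀ᵐ t : I, q t ≪ᵥ (ρ t : Measure Ω).toENNRealVectorMeasure ∧
        BranchedTransport.IsPurelyAtomic (q t).variation := by
  open BranchedTransport in
  have : CompactSpace Ω := isCompact_iff_compactSpace.1 hΩ_compact
  obtain ⟨C, hC⟩ := hτ.bounded
  have hvar : ∀ n, ∀ᵐ t : I, (qn n t).variation Set.univ ≤ C := fun n => (hC n).mono fun t ht =>
    ((variation_le_atomicCost hα_lt_one (ρn n t) (qn n t)).trans
      (atomicCost_le_F hα_pos _ _)).trans ht
  have hunif := tendstoUniformly_smoothedMass hn hvar hτ.tendsto_density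
  have hcont : ∀ j, Continuous fun p : I × Ω => weight α j (ρ p.1) p.2 := fun j => by
    have hm := (hunif j).continuous (Eventually.of_forall fun n =>
      (lipschitzWith_smoothedMass_prod (hn n) (hvar n) j).continuous).frequently
    exact (continuous_const.add hm).rpow_const fun p => Or.inl (smoothedMass_add_pos _ _ _).ne'
  have hweight : ∀ j, ∀ᶠ n in atTop,
      ∫⁻ t : I, ∫⁻ x, ENNReal.ofReal (weight α j (ρ t) x) ∂(qn n t).variation
        ≤ cost α (ρn n) (qn n) := fun j => by
    -- The tolerance is the offset built into `weight`, which absorbs the uniform error.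
    filter_upwards [Metric.tendstoUniformly_iff.1 (hunif j) (1 / ((j : ℝ) + 1)) (by positivity)]
      with n hclose
    refine lintegral_mono fun t => lintegral_weight_le_F hα_pos hα_lt_one (fun x => ?_) (qn n t)
    have := hclose (t, x)
    rw [Real.dist_eq, abs_lt] at this
    linarith [this.1]
  have hlsc := fun j => lintegral_weighted_variation_le (w := ⟨_, hcont j⟩)
    (fun p => weight_nonneg α j (ρ p.1) p.2) hq hτ.tendsto_flux (hweight j)
  have hF : ∀ t : I, F α (ρ t) (q t)
      ≤ liminf (fun j => ∫⁻ x, ENNReal.ofReal (weight α j (ρ t) x) ∂(q t).variation) atTop :=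
    fun t => F_le_liminf_lintegral_weight hα_pos hα_lt_one (ρ t)
      (fun j => (hcont j).comp (Continuous.prodMk_right t)) (q t)
  have hfatou : ∫⁻ t : I, liminf (fun j => ∫⁻ x, ENNReal.ofReal (weight α j (ρ t) x)
      ∂(q t).variation) atTop ≤ liminf (fun n => cost α (ρn n) (qn n)) atTop :=
    (lintegral_liminf_le' fun j => (hlsc j).1).trans
      ((liminf_le_liminf (Eventually.of_forall fun j => (hlsc j).2)).trans_eq (liminf_const _))
  refine ⟨(lintegral_mono hF).trans hfatou, ?_⟩
  have hbound : liminf (fun n => cost α (ρn n) (qn n)) atTop ≤ C := by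
    refine (liminf_le_liminf (v := fun _ => (C : ℝ≥0∞))
      (Eventually.of_forall fun n => ?_)).trans_eq (liminf_const _)
    exact (lintegral_mono_ae (hC n)).trans_eq (by simp)
  -- This liminf is a measurable majorant of t ↦ F(ρ_t, q_t), whose own measurability is never
  -- needed; a finite integral makes it finite almost everywhere.
  have hmeas : AEMeasurable fun t : I => liminf (fun j => ∫⁻ x, ENNReal.ofReal (weight α j (ρ t) x)
      ∂(q t).variation) atTop := by
    simp_rw [liminf_eq_iSup_iInf_of_nat]
    exact AEMeasurable.iSup fun k => AEMeasurable.iInf fun j => AEMeasurable.iInf fun _ =>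
      (hlsc j).1
  have hae := ae_lt_top' hmeas
    ((hfatou.trans hbound).trans_lt ENNReal.coe_lt_top).ne
  filter_upwards [hae] with t ht
  have hfin : atomicCost α (ρ t) (q t) ≠ ⊤ :=
    ((atomicCost_le_F hα_pos _ _).trans_lt ((hF t).trans_lt ht)).ne
  exact ⟨absolutelyContinuous_of_atomicCost_ne_top hα_lt_one hfin,
    isPurelyAtomic_variation hα_lt_one hfin⟩
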